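/- Write $\mathbb T=\{|\zeta|=1\}$. Let $w$ be a complex function with Fourier coefficients $w_k=\int_{\mathbb T}\frac{d\zeta}{2\pi i\zeta}w(\zeta)\zeta^{-k}$ such that $w(z)=\sum_{k\in\mathbb Z}w_kz^k$, with convergence in an open annulus containing $\mathbb T$. Let $\{\varphi_n,\bar\varphi_n\}_{n\ge0}$ be a bi-orthonormal polynomial system for $w$: $\deg\varphi_n=\deg\bar\varphi_n=n$, both with the same leading coefficient $\kappa_n$ (where $\bar\varphi_n$ need not be the complex conjugate of $\varphi_n$), and $$\int_{\mathbb T}\frac{d\zeta}{2\pi i\zeta}w(\zeta)\varphi_m(\zeta)\bar\varphi_n(\bar\zeta)=\delta_{m,n}.$$ Put $r_n=\varphi_n(0)/\kappa_n$ and $\bar r_n=\bar\varphi_n(0)/\kappa_n$. Assume: (i) $w(e^{i\theta})\in L_p[-\pi,\pi]$ for some $p>1$; (ii) $w$ has no zeros on $\mathbb T$ and winding number zero, and the Fourier coefficients $c_p$ of a continuous $\log w$ on $\mathbb T$ satisfy $\sum_{p\in\mathbb Z}|p||c_p|^2<\infty$; (iii) $\sum_{n\ge0}\sqrt{|r_n\bar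 r_n|}<\infty$; (iv) $\kappa_n\to\kappa_\infty$ as $n\to\infty$. Consider the recurrence $$\Psi_{n+1}=\frac1{\kappa_n}\begin{pmatrix}\kappa_{n+1}z&\varphi_{n+1}(0)z^n\\ \bar\varphi_{n+1}(0)z^{-n}&\kappa_{n+1}z^{-1}\end{pmatrix}\Psi_n,\qquad n\ge0, \tag{R}$$ which is solved by $\Psi_n(z)=(\varphi_n(z),\bar\varphi_n(z^{-1}))^T$. The scattering states are solutions $\Psi_{+n}=(\phi_{+n},\hat\phi_{+n})^T$ of (R) for $0<|z|\le1$, holomorphic in $|z|<1$ and continuous on $|z|\le1$, with $\phi_{+n}(z)-z^n\to0$ and $\hat\phi_{+n}(z)\to0$ as $n\to\infty$ for each $|z|\le1$; and $\Psi_{-n}=(\hat\phi_{-n},\phi_{-n})^T$ of (R) for $|z|\ge1$, holomorphic in $|z|>1$ and continuous on $|z|\ge1$, with $\hat\phi_{-n}(z)\to0$ and $\phi_{-n}(z)-z^{-n}\to0$ for each $|z|\ge1$. The Jost functions $f_\pm$ on $\mathbb T$ are defined by $\Psi_n=f_-\Psi_{+n}+f_+\Psi_{-n}$ for all $n\ge0$.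 The coefficients $A_1,A_2,\bar A_1,\bar A_2$ are defined by $$\phi_{+n}=\sum_{n'\ge n}A_1(n,n')z^{n'},\quad \hat\phi_{+n}=\sum_{n'\ge1}A_2(n,n')z^{n'}\quad(|z|<1),$$ $$\phi_{-n}=\sum_{n'\ge n}\bar A_1(n,n')z^{-n'},\quad \hat\phi_{-n}=\sum_{n'\ge1}\bar A_2(n,n')z^{-n'}\quad(|z|>1).$$ The scattering function is $S=f_- /f_+$ on $\mathbb T$, and $$F_m=\int_{\mathbb T}\frac{dz}{2\pi iz}z^mS(z),\qquad \bar F_m=\int_{\mathbb T}\frac{dz}{2\pi iz}z^{-m}\frac1{S(z)},\qquad m\in\mathbb Z.$$ **Proposition.** Then $\kappa_\infty\ne0$; the scattering states, the Jost functions and the expansions above exist; $f_\pm$ have no zeros on $\mathbb T$; $S$ and $1/S$ are integrable on $\mathbb T$; and for all objects as above the following linear relations hold, all the series being absolutely convergent: \begin{align*} \frac{\kappa_n}{\kappa_\infty}\delta_{m,n}&=A_1(n,m)+\sum_{n'\ge1}\bar A_2(n,n')\bar F_{n'+m},&& m\ge n\ge1,\\ 0&=\bar A_2(n,m)+\sum_{n'\ge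 n}A_1(n,n')F_{n'+m},&& m,n>0,\\ \frac{\kappa_n}{\kappa_\infty}\delta_{m,n}&=\bar A_1(n,m)+\sum_{n'\ge1}A_2(n,n')F_{n'+m},&& m\ge n\ge1,\\ 0&=A_2(n,m)+\sum_{n'\ge n}\bar A_1(n,n')\bar F_{n'+m},&& m,n>0. \end{align*} -/

import Mathlib

open Polynomial Filter Topology MeasureTheory

noncomputable section

namespace Marchenko

/-- The mean `∫_𝕋 g(ζ) dζ / (2πiζ)` of a function over the unit circle. -/
def circleMean (g : ℂ → ℂ) : ℂ :=
  (2 * (Real.pi : ℂ) * Complex.I)⁻¹ * ∮ z in C(0, 1), z⁻¹ * g z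

/-- The `k`-th Fourier (trigonometric) coefficient `∫_𝕋 g(ζ) ζ^{-k} dζ / (2πiζ)`, `k ∈ ℤ`. -/
def fourierCoef (g : ℂ → ℂ) (k : ℤ) : ℂ :=
  circleMean fun ζ => g ζ * ζ ^ (-k)

/-- The weight is the sum of its Fourier series in an open annulus that contains the unit circle. -/
def ConvergesInAnnulus (w : ℂ → ℂ) : Prop :=
  ∃ Δ₁ Δ₂ : ℝ, 0 ≤ Δ₁ ∧ Δ₁ < 1 ∧ 1 < Δ₂ ∧
    ∀ z : ℂ, Δ₁ < ‖z‖ → ‖z‖ < Δ₂ → HasSum (fun k : ℤ => fourierCoef w k * z ^ k) (w z)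

/-- The symbol lies in `L_p` of the circle for some `p > 1`. -/
def IsLpSymbol (w : ℂ → ℂ) : Prop :=
  ∃ p : ENNReal, 1 < p ∧
    MemLp (fun θ : ℝ => w (Complex.exp (θ * Complex.I))) p
      (volume.restrict (Set.Icc (-Real.pi) Real.pi))

/-- Zero winding number and Szegő's condition: the symbol has a continuous logarithm `L` on the
unit circle (that is, it does not vanish there and has winding number zero about the origin), and
the Fourier coefficients `c_p` of `L` satisfy `∑ |p| |c_p|² < ∞`. -/
def SzegoCondition (w : ℂ → ℂ) : Prop :=
  ∃ L : ℂ → ℂ, ContinuousOn L (Metric.sphere 0 1) ∧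
    (∀ z ∈ Metric.sphere (0 : ℂ) 1, Complex.exp (L z) = w z) ∧
    Summable fun p : ℤ => |(p : ℝ)| * ‖fourierCoef L p‖ ^ 2

/-- A bi-orthonormal polynomial system `{φ_n, φbar_n}` with respect to the weight `w`, normalised
so that `φ_n` and `φbar_n` have the same leading coefficient. The polynomial `φbar_n` is not
assumed to be the complex conjugate of `φ_n`; on the circle `ζ⁻¹` is the conjugate of `ζ`. -/
structure IsBiorthonormalSystem (w : ℂ → ℂ) (φ φbar : ℕ → ℂ[X]) : Prop where
  natDegree_left : ∀ n, (φ n).natDegree = n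
  natDegree_right : ∀ n, (φbar n).natDegree = n
  leadingCoeff_eq : ∀ n, (φbar n).leadingCoeff = (φ n).leadingCoeff
  orthonormal : ∀ m n,
    circleMean (fun ζ => w ζ * (φ m).eval ζ * (φbar n).eval ζ⁻¹) = if m = n then 1 else 0

/-- The common leading coefficient `κ_n`. -/
def kappa (φ : ℕ → ℂ[X]) (n : ℕ) : ℂ := (φ n).leadingCoeff

/-- The reflection coefficient `r_n = φ_n(0) / κ_n`; for the companion `rbar_n = φbar_n(0) / κ_n`
use the second family, which has the same leading coefficients. -/
def reflCoeff (φ : ℕ → ℂ[X]) (n : ℕ) : ℂ := (φ n).eval 0 / kappa φ n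

/-- The matrix of the recurrence `Ψ_{n+1} = K_n(z) Ψ_n` satisfied by
`Ψ_n(z) = (φ_n(z), φbar_n(1/z))`. -/
def transferMatrix (φ φbar : ℕ → ℂ[X]) (n : ℕ) (z : ℂ) : Matrix (Fin 2) (Fin 2) ℂ :=
  (kappa φ n)⁻¹ •
    !![kappa φ (n + 1) * z, (φ (n + 1)).eval 0 * z ^ n;
       (φbar (n + 1)).eval 0 * (z ^ n)⁻¹, kappa φ (n + 1) * z⁻¹]

/-- The scattering state `Ψ_{+n} = (φ_{+n}, φhat_{+n})`: holomorphic in the open unit disc and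
continuous up to the circle, a solution of the recurrence, with `φ_{+n} - z^n → 0` and
`φhat_{+n} → 0` as `n → ∞`. -/
structure IsScatteringPlus (φ φbar : ℕ → ℂ[X]) (Ψ : ℕ → ℂ → Fin 2 → ℂ) : Prop where
  differentiableOn : ∀ n i, DifferentiableOn ℂ (fun z => Ψ n z i) {z | ‖z‖ < 1}
  continuousOn : ∀ n i, ContinuousOn (fun z => Ψ n z i) {z | ‖z‖ ≤ 1}
  recurrence : ∀ n z, z ≠ 0 → ‖z‖ ≤ 1 →
    Ψ (n + 1) z = (transferMatrix φ φbar n z).mulVec (Ψ n z)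
  tendsto_fst : ∀ z, ‖z‖ ≤ 1 → Tendsto (fun n => ‖Ψ n z 0 - z ^ n‖) atTop (𝓝 0)
  tendsto_snd : ∀ z, ‖z‖ ≤ 1 → Tendsto (fun n => ‖Ψ n z 1‖) atTop (𝓝 0)

/-- The scattering state `Ψ_{-n} = (φhat_{-n}, φ_{-n})`: holomorphic outside the closed unit disc
and continuous up to the circle, a solution of the recurrence, with `φhat_{-n} → 0` and
`φ_{-n} - z^{-n} → 0` as `n → ∞`. -/
structure IsScatteringMinus (φ φbar : ℕ → ℂ[X]) (Ψ : ℕ → ℂ → Fin 2 → ℂ) : Prop where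
  differentiableOn : ∀ n i, DifferentiableOn ℂ (fun z => Ψ n z i) {z | 1 < ‖z‖}
  continuousOn : ∀ n i, ContinuousOn (fun z => Ψ n z i) {z | 1 ≤ ‖z‖}
  recurrence : ∀ n z, 1 ≤ ‖z‖ →
    Ψ (n + 1) z = (transferMatrix φ φbar n z).mulVec (Ψ n z)
  tendsto_fst : ∀ z, 1 ≤ ‖z‖ → Tendsto (fun n => ‖Ψ n z 0‖) atTop (𝓝 0)
  tendsto_snd : ∀ z, 1 ≤ ‖z‖ → Tendsto (fun n => ‖Ψ n z 1 - (z ^ n)⁻¹‖) atTop (𝓝 0)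

/-- The Jost functions `f_+`, `f_-` on the unit circle: the coefficients in the decomposition
`(φ_n(z), φbar_n(1/z)) = f_-(z) Ψ_{+n}(z) + f_+(z) Ψ_{-n}(z)`. -/
def AreJostFunctions (φ φbar : ℕ → ℂ[X]) (Ψp Ψm : ℕ → ℂ → Fin 2 → ℂ) (fp fm : ℂ → ℂ) : Prop :=
  ∀ n z, ‖z‖ = 1 → ![(φ n).eval z, (φbar n).eval z⁻¹] = fm z • Ψp n z + fp z • Ψm n z

/-- The expansions of the scattering states in monomials:
`φ_{+n} = ∑_{n' ≥ n} A₁(n,n') z^{n'}`, `φhat_{+n} = ∑_{n' ≥ 1} A₂(n,n') z^{n'}` for `|z| < 1`, and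
`φ_{-n} = ∑_{n' ≥ n} B₁(n,n') z^{-n'}`, `φhat_{-n} = ∑_{n' ≥ 1} B₂(n,n') z^{-n'}` for `|z| > 1`,
where `B₁`, `B₂` stand for `A₁`-bar and `A₂`-bar. -/
structure HaveExpansions (Ψp Ψm : ℕ → ℂ → Fin 2 → ℂ) (A₁ A₂ B₁ B₂ : ℕ → ℕ → ℂ) : Prop where
  plus_fst : ∀ n z, ‖z‖ < 1 → HasSum (fun k : ℕ => A₁ n (n + k) * z ^ (n + k)) (Ψp n z 0)
  plus_snd : ∀ n z, ‖z‖ < 1 → HasSum (fun k : ℕ => A₂ n (k + 1) * z ^ (k + 1)) (Ψp n z 1)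
  minus_snd : ∀ n z, 1 < ‖z‖ →
    HasSum (fun k : ℕ => B₁ n (n + k) * (z ^ (n + k))⁻¹) (Ψm n z 1)
  minus_fst : ∀ n z, 1 < ‖z‖ →
    HasSum (fun k : ℕ => B₂ n (k + 1) * (z ^ (k + 1))⁻¹) (Ψm n z 0)

/-- The scattering function `S = f_- / f_+` on the unit circle. -/
def scatteringFun (fp fm : ℂ → ℂ) (z : ℂ) : ℂ := fm z / fp z

/-- `F_m = ∫_𝕋 z^m S(z) dz / (2πiz)`. -/
def scatF (fp fm : ℂ → ℂ) (m : ℤ) : ℂ :=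
  circleMean fun z => z ^ m * scatteringFun fp fm z

/-- `Fbar_m = ∫_𝕋 z^{-m} S(z)⁻¹ dz / (2πiz)`. -/
def scatFbar (fp fm : ℂ → ℂ) (m : ℤ) : ℂ :=
  circleMean fun z => z ^ (-m) * (1 / scatteringFun fp fm z)

/-- All the objects attached to the bi-orthogonal system: its two scattering states, the Jost
functions, and the expansion coefficients. -/
structure IsScatteringSystem (φ φbar : ℕ → ℂ[X]) (Ψp Ψm : ℕ → ℂ → Fin 2 → ℂ) (fp fm : ℂ → ℂ)
    (A₁ A₂ B₁ B₂ : ℕ → ℕ → ℂ) : Prop where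
  plus : IsScatteringPlus φ φbar Ψp
  minus : IsScatteringMinus φ φbar Ψm
  jost : AreJostFunctions φ φbar Ψp Ψm fp fm
  expansions : HaveExpansions Ψp Ψm A₁ A₂ B₁ B₂

end Marchenko

end

noncomputable section

namespace Marchenko

/-! ### Absolutely summable Laurent series -/

/-! The setting is the Wiener algebra of absolutely summable Laurent series, in which convolution of
coefficients is multiplication on the circle. Since w is analytic near the circle and has a
continuous logarithm on it, w = w₊ w₋, where w₊ and 1/w₊ are power series in z, and w₋ and 1/w₋ are
power series in 1/z (`exists_wienerHopf`). Bi-orthogonality says that the Fourier coefficients of w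
φ_n vanish at 0, …, n - 1 (`IsOrtho.weighted_eq_zero`). So w φ_n is the sum of a part with indices
at least n and a part with negative indices. Dividing the first by w₊ and the second by w₋ gives
φ_{+n} and φhat_{-n}, and then φ_n = φ_{+n}/w₋ + φhat_{-n}/w₊ (`eval_eq_add`). Hence f_- = 1/w₋, f_+
= 1/w₊ and S = w₊/w₋.

The Marchenko relations are this identity multiplied by w₋ or by w₊. In φ_n w₋ = φ_{+n} +
φhat_{-n}/S the left side has no index above n; in φ_n w₊ = φ_{+n} S + φhat_{-n} it has no negative
index (`marchenko_wave`, `marchenko_tail`). The other two relations follow from the reflection z ↦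
1/z, which exchanges φ with φbar and w₊ with w₋ (`IsOrtho.symm`, `IsWienerHopf.symm`).

The same relations, read as ℓ¹ estimates, give the asymptotics: the couplings are far tails of the
coefficients of S and 1/S, which tend to zero. This yields κ_∞² m₀ = (1/w₊)₀, with m₀ the constant
coefficient of w₋, so κ_∞ ≠ 0 (`kappa_limit_sq`). It also allows w₊ and w₋ to be rescaled so that
φ_{+n} - z^n tends to zero. The recurrence (R) is Szegő's recurrence projected onto nonnegative or
positive indices and divided by w₊.

Finally, the matrices in (R) have determinant one, so Wronskians of solutions are constant and can
be computed at n = ∞. This fixes the scattering states and the Jost functions on the circle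
(`scatteringPlus_unique`, `jost_eq`), and the boundary values fix the expansion coefficients
(`coeff_eq_fourierCoef`). Every scattering system therefore carries the constructed data. -/

/-- The sum of the Laurent series with coefficients `a`. -/
def laurentSum (a : ℤ → ℂ) (z : ℂ) : ℂ := ∑' k : ℤ, a k * z ^ k

/-- The convolution of two sequences indexed by `ℤ`. -/
def conv (a b : ℤ → ℂ) (k : ℤ) : ℂ := ∑' j : ℤ, a j * b (k - j)

/-- The `ℓ¹` norm. -/
def l1 (a : ℤ → ℂ) : ℝ := ∑' k : ℤ, ‖a k‖

/-- The part of a sequence with indices in `s`. -/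
def restr (s : Set ℤ) (a : ℤ → ℂ) : ℤ → ℂ := s.indicator a

/-- The reflected sequence, which belongs to `f (z⁻¹)`. -/
def reversed (a : ℤ → ℂ) (k : ℤ) : ℂ := a (-k)

theorem reversed_reversed (a : ℤ → ℂ) : reversed (reversed a) = a := by
  funext k; simp [reversed]

theorem summable_reversed {a : ℤ → ℂ} (ha : Summable a) : Summable (reversed a) :=
  (Equiv.neg ℤ).summable_iff.mpr ha

theorem l1_reversed (a : ℤ → ℂ) : l1 (reversed a) = l1 a :=
  (Equiv.neg ℤ).tsum_eq fun k => ‖a k‖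

theorem laurentSum_reversed (a : ℤ → ℂ) (z : ℂ) : laurentSum (reversed a) z = laurentSum a z⁻¹ := by
  unfold laurentSum
  rw [← (Equiv.neg ℤ).tsum_eq fun k => a k * z⁻¹ ^ k]
  simp [reversed]

theorem summable_restr {a : ℤ → ℂ} (ha : Summable a) (s : Set ℤ) : Summable (restr s a) :=
  ha.indicator s

theorem restr_of_mem {s : Set ℤ} {k : ℤ} (a : ℤ → ℂ) (h : k ∈ s) : restr s a k = a k :=
  Set.indicator_of_mem h a

theorem restr_of_notMem {s : Set ℤ} {k : ℤ} (a : ℤ → ℂ) (h : k ∉ s) : restr s a k = 0 :=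
  Set.indicator_of_notMem h a

theorem norm_restr_le (s : Set ℤ) (a : ℤ → ℂ) (k : ℤ) : ‖restr s a k‖ ≤ ‖a k‖ :=
  norm_indicator_le_norm_self a k

theorem l1_nonneg (a : ℤ → ℂ) : 0 ≤ l1 a := tsum_nonneg fun _ => norm_nonneg _

theorem l1_mono {a b : ℤ → ℂ} (hb : Summable b) (h : ∀ k, ‖a k‖ ≤ ‖b k‖) : l1 a ≤ l1 b :=
  Summable.tsum_le_tsum h (hb.norm.of_nonneg_of_le (fun _ => norm_nonneg _) h) hb.norm

theorem norm_le_l1 {a : ℤ → ℂ} (ha : Summable a) (k : ℤ) : ‖a k‖ ≤ l1 a :=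
  ha.norm.le_tsum k fun _ _ => norm_nonneg _

theorem summable_mul_zpow {a : ℤ → ℂ} (ha : Summable a) {z : ℂ} (hz : ‖z‖ = 1) :
    Summable fun k => a k * z ^ k := by
  rw [← summable_norm_iff]
  simpa [hz] using ha.norm

theorem ne_zero_of_circle {z : ℂ} (hz : ‖z‖ = 1) : z ≠ 0 := by
  rintro rfl; simp at hz

theorem circleMean_zpow (k : ℤ) : circleMean (fun z => z ^ k) = if k = 0 then 1 else 0 := by
  have key : (∮ z in C(0, 1), z⁻¹ * z ^ k) = ∮ z in C(0, 1), (z - 0) ^ (k - 1) := by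
    refine circleIntegral.integral_congr zero_le_one fun z hz => ?_
    have hz0 : z ≠ 0 := ne_zero_of_circle (by simpa using hz)
    simp only [sub_zero]
    rw [zpow_sub_one₀ hz0, mul_comm]
  unfold circleMean
  rw [key]
  split_ifs with h
  · subst h
    have h2 := circleIntegral.integral_sub_center_inv 0 (R := 1) one_ne_zero
    simp only [zero_sub, zpow_neg_one]
    rw [h2]
    exact inv_mul_cancel₀ Complex.two_pi_I_ne_zero
  · rw [circleIntegral.integral_sub_zpow_of_ne (by omega), mul_zero]

theorem hasSum_circleMean {ι : Type*} [Countable ι] {F : ι → ℂ → ℂ} {f : ℂ → ℂ} {u : ι → ℝ}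
    (hu : Summable u)
    (hF : ∀ k, ContinuousOn (F k) (Metric.sphere 0 1))
    (hFu : ∀ k z, ‖z‖ = 1 → ‖F k z‖ ≤ u k)
    (hf : ∀ z, ‖z‖ = 1 → HasSum (fun k => F k z) (f z)) :
    HasSum (fun k => circleMean (F k)) (circleMean f) := by
  unfold circleMean
  refine HasSum.mul_left _ ?_
  unfold circleIntegral
  have hc : ∀ θ : ℝ, ‖circleMap 0 1 θ‖ = 1 := fun θ => by simp
  refine intervalIntegral.hasSum_integral_of_dominated_convergence (fun k _ => u k) ?_ ?_ ?_ ?_ ?_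
  · intro k
    refine Continuous.aestronglyMeasurable ?_
    have h1 : Continuous fun θ : ℝ => F k (circleMap 0 1 θ) :=
      (hF k).comp_continuous (continuous_circleMap 0 1) fun θ => by simp
    have h2 : Continuous fun θ : ℝ => (circleMap 0 1 θ)⁻¹ :=
      (continuous_circleMap 0 1).inv₀ fun θ => ne_zero_of_circle (hc θ)
    simp only [deriv_circleMap, smul_eq_mul]
    exact ((continuous_circleMap 0 1).mul continuous_const).mul (h2.mul h1)
  · refine fun k => Eventually.of_forall fun θ _ => ?_
    simpa using hFu k _ (hc θ)
  · exact Eventually.of_forall fun θ _ => hu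
  · exact intervalIntegrable_const
  · refine Eventually.of_forall fun θ _ => ?_
    simp only [smul_eq_mul]
    exact ((hf _ (hc θ)).mul_left _).mul_left _

theorem continuousOn_mul_zpow (c : ℂ) (k : ℤ) :
    ContinuousOn (fun z : ℂ => c * z ^ k) (Metric.sphere 0 1) := fun z hz =>
  (continuousAt_const.mul (continuousAt_zpow₀ z k
    (Or.inl (ne_zero_of_circle (by simpa using hz))))).continuousWithinAt

theorem circleMean_const_mul (c : ℂ) (f : ℂ → ℂ) :
    circleMean (fun z => c * f z) = c * circleMean f := by
  unfold circleMean
  rw [mul_left_comm c, ← circleIntegral.integral_const_mul c]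
  simp only [mul_left_comm c]

theorem fourierCoef_of_hasSum {a : ℤ → ℂ} (ha : Summable a) {f : ℂ → ℂ}
    (hf : ∀ z, ‖z‖ = 1 → HasSum (fun k => a k * z ^ k) (f z)) (k : ℤ) :
    fourierCoef f k = a k := by
  have h := hasSum_circleMean (F := fun j z => a j * z ^ (j - k))
    (f := fun z => f z * z ^ (-k)) ha.norm
    (fun j => continuousOn_mul_zpow _ _) (fun j z hz => by simp [hz])
    (fun z hz => by
      have h := (hf z hz).mul_right (z ^ (-k))
      simpa only [mul_assoc, ← zpow_add₀ (ne_zero_of_circle hz), ← sub_eq_add_neg] using h)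
  simp only [circleMean_const_mul, circleMean_zpow] at h
  refine h.unique ?_
  have h2 := hasSum_ite_eq k (a k)
  refine h2.congr_fun fun j => ?_
  by_cases hj : j = k
  · simp [hj]
  · simp [hj, sub_eq_zero]

theorem fourierCoef_of_eq {a : ℤ → ℂ} (ha : Summable a) {f : ℂ → ℂ}
    (hf : ∀ z, ‖z‖ = 1 → f z = laurentSum a z) (k : ℤ) : fourierCoef f k = a k :=
  fourierCoef_of_hasSum ha (fun z hz => by
    rw [hf z hz]; exact (summable_mul_zpow ha hz).hasSum) k

/-- Reduces identities between convolutions to pointwise algebra on the circle, where convolution is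
multiplication. -/
theorem laurentSum_injective {a b : ℤ → ℂ} (ha : Summable a) (hb : Summable b)
    (h : ∀ z, ‖z‖ = 1 → laurentSum a z = laurentSum b z) : a = b := by
  funext k
  rw [← fourierCoef_of_eq ha (fun _ _ => rfl) k, fourierCoef_of_eq hb h k]

/-- The shear `(k, j) ↦ (j, k - j)` of `ℤ × ℤ`. -/
def shear : ℤ × ℤ ≃ ℤ × ℤ where
  toFun q := (q.2, q.1 - q.2)
  invFun q := (q.1 + q.2, q.1)
  left_inv q := by ext <;> simp
  right_inv q := by ext <;> simp

theorem summable_shear {a b : ℤ → ℂ} (ha : Summable a) (hb : Summable b) :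
    Summable fun q : ℤ × ℤ => a q.2 * b (q.1 - q.2) :=
  shear.summable_iff.mpr (summable_mul_of_summable_norm ha.norm hb.norm)

theorem summable_conv {a b : ℤ → ℂ} (ha : Summable a) (hb : Summable b) :
    Summable (conv a b) := (summable_shear ha hb).prod

theorem summable_conv_apply {a b : ℤ → ℂ} (ha : Summable a) (hb : Summable b) (k : ℤ) :
    Summable fun j => a j * b (k - j) := (summable_shear ha hb).prod_factor k

theorem l1_conv_le {a b : ℤ → ℂ} (ha : Summable a) (hb : Summable b) :
    l1 (conv a b) ≤ l1 a * l1 b := by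
  have hs := (summable_shear ha hb).norm
  unfold l1
  rw [tsum_mul_tsum_of_summable_norm ha.norm.norm hb.norm.norm,
    ← shear.tsum_eq fun q : ℤ × ℤ => ‖a q.1‖ * ‖b q.2‖]
  have hs' : Summable fun q : ℤ × ℤ => ‖a q.2‖ * ‖b (q.1 - q.2)‖ := by simpa using hs
  have e := hs'.tsum_prod
  refine le_of_le_of_eq ?_ e.symm
  refine Summable.tsum_le_tsum (fun k => ?_) (summable_conv ha hb).norm hs'.prod
  refine (norm_tsum_le_tsum_norm (summable_conv_apply ha hb k).norm).trans ?_
  simp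

theorem tsum_conv {a b : ℤ → ℂ} (ha : Summable a) (hb : Summable b) :
    ∑' k, conv a b k = (∑' k, a k) * ∑' k, b k := by
  rw [tsum_mul_tsum_of_summable_norm ha.norm hb.norm,
    ← shear.tsum_eq fun q : ℤ × ℤ => a q.1 * b q.2]
  exact (summable_shear ha hb).tsum_prod.symm

theorem conv_mul_zpow (a b : ℤ → ℂ) {z : ℂ} (hz : z ≠ 0) (k : ℤ) :
    conv a b k * z ^ k = conv (fun j => a j * z ^ j) (fun j => b j * z ^ j) k := by
  unfold conv
  rw [← tsum_mul_right]
  congr 1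
  funext j
  have : z ^ k = z ^ j * z ^ (k - j) := by rw [← zpow_add₀ hz]; congr 1; ring
  rw [this]; ring

theorem laurentSum_conv {a b : ℤ → ℂ} {z : ℂ} (hz : z ≠ 0)
    (ha : Summable fun k => a k * z ^ k) (hb : Summable fun k => b k * z ^ k) :
    laurentSum (conv a b) z = laurentSum a z * laurentSum b z := by
  unfold laurentSum
  rw [← tsum_conv ha hb]
  exact tsum_congr fun k => conv_mul_zpow a b hz k

theorem laurentSum_conv_circle {a b : ℤ → ℂ} (ha : Summable a) (hb : Summable b) {z : ℂ}
    (hz : ‖z‖ = 1) : laurentSum (conv a b) z = laurentSum a z * laurentSum b z :=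
  laurentSum_conv (ne_zero_of_circle hz) (summable_mul_zpow ha hz) (summable_mul_zpow hb hz)

theorem reversed_conv (a b : ℤ → ℂ) : reversed (conv a b) = conv (reversed a) (reversed b) := by
  funext k
  unfold reversed conv
  rw [← (Equiv.neg ℤ).tsum_eq]
  refine tsum_congr fun j => ?_
  simp only [Equiv.neg_apply]
  congr 2; ring

/-- Supports add under convolution, and the extreme coefficient of a product is the product of the
extreme coefficients. This and the next three lemmas are the two one-sided versions. -/
theorem conv_eq_zero_of_lt {a b : ℤ → ℂ} {n k : ℤ} (ha : ∀ j < n, a j = 0)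
    (hb : ∀ j < 0, b j = 0) (hk : k < n) : conv a b k = 0 := by
  unfold conv
  rw [← tsum_zero (β := ℤ)]
  refine tsum_congr fun j => ?_
  rcases lt_or_ge j n with h | h
  · rw [ha j h, zero_mul]
  · rw [hb (k - j) (by omega), mul_zero]

theorem conv_eq_mul_of_le {a b : ℤ → ℂ} {n : ℤ} (ha : ∀ j < n, a j = 0)
    (hb : ∀ j < 0, b j = 0) : conv a b n = a n * b 0 := by
  unfold conv
  rw [tsum_eq_single n, sub_self]
  intro j hj
  rcases lt_or_ge j n with h | h
  · rw [ha j h, zero_mul]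
  · rw [hb (n - j) (by omega), mul_zero]

theorem conv_eq_zero_of_gt {a b : ℤ → ℂ} {n k : ℤ} (ha : ∀ j > n, a j = 0)
    (hb : ∀ j > 0, b j = 0) (hk : n < k) : conv a b k = 0 := by
  unfold conv
  rw [← tsum_zero (β := ℤ)]
  refine tsum_congr fun j => ?_
  rcases lt_or_ge n j with h | h
  · rw [ha j h, zero_mul]
  · rw [hb (k - j) (by omega), mul_zero]

theorem conv_eq_mul_of_ge {a b : ℤ → ℂ} {n : ℤ} (ha : ∀ j > n, a j = 0)
    (hb : ∀ j > 0, b j = 0) : conv a b n = a n * b 0 := by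
  unfold conv
  rw [tsum_eq_single n, sub_self]
  intro j hj
  rcases lt_or_gt_of_ne hj with h | h
  · rw [hb (n - j) (by omega), mul_zero]
  · rw [ha j h, zero_mul]

/-! ### Power series on the closed unit disc -/

theorem norm_mul_zpow_le {a : ℤ → ℂ} (ha : ∀ k < 0, a k = 0) {z : ℂ} (hz : ‖z‖ ≤ 1) (k : ℤ) :
    ‖a k * z ^ k‖ ≤ ‖a k‖ := by
  rcases lt_or_ge k 0 with h | h
  · simp [ha k h]
  · lift k to ℕ using h
    rw [norm_mul, zpow_natCast, norm_pow]
    exact mul_le_of_le_one_right (norm_nonneg _) (pow_le_one₀ (norm_nonneg _) hz)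

theorem summable_disc {a : ℤ → ℂ} (hs : Summable a) (ha : ∀ k < 0, a k = 0) {z : ℂ}
    (hz : ‖z‖ ≤ 1) : Summable fun k => a k * z ^ k :=
  hs.norm.of_norm_bounded fun k => norm_mul_zpow_le ha hz k

theorem norm_laurentSum_le {a : ℤ → ℂ} (hs : Summable a) (ha : ∀ k < 0, a k = 0) {z : ℂ}
    (hz : ‖z‖ ≤ 1) : ‖laurentSum a z‖ ≤ l1 a :=
  (norm_tsum_le_tsum_norm (summable_disc hs ha hz).norm).trans
    (Summable.tsum_le_tsum (norm_mul_zpow_le ha hz) (summable_disc hs ha hz).norm hs.norm)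

theorem differentiable_mul_zpow {a : ℤ → ℂ} (ha : ∀ k < 0, a k = 0) (k : ℤ) :
    Differentiable ℂ fun z : ℂ => a k * z ^ k := by
  rcases lt_or_ge k 0 with h | h
  · simp [ha k h]
  · lift k to ℕ using h
    simp only [zpow_natCast]
    fun_prop

theorem continuousOn_laurentSum {a : ℤ → ℂ} (hs : Summable a) (ha : ∀ k < 0, a k = 0) :
    ContinuousOn (laurentSum a) {z | ‖z‖ ≤ 1} :=
  continuousOn_tsum (fun k => (differentiable_mul_zpow ha k).continuous.continuousOn) hs.norm
    fun k _ hz => norm_mul_zpow_le ha hz k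

theorem isOpen_norm_lt_one : IsOpen {z : ℂ | ‖z‖ < 1} :=
  isOpen_lt continuous_norm continuous_const

theorem differentiableOn_laurentSum {a : ℤ → ℂ} (hs : Summable a) (ha : ∀ k < 0, a k = 0) :
    DifferentiableOn ℂ (laurentSum a) {z | ‖z‖ < 1} :=
  Complex.differentiableOn_tsum_of_summable_norm hs.norm
    (fun k => (differentiable_mul_zpow ha k).differentiableOn) isOpen_norm_lt_one
    fun k _ hz => norm_mul_zpow_le ha (le_of_lt hz) k

theorem hasSum_nat_laurentSum {a : ℤ → ℂ} (hs : Summable a) {n : ℕ}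
    (ha : ∀ k < (n : ℤ), a k = 0) {z : ℂ} (hz : ‖z‖ ≤ 1) :
    HasSum (fun k : ℕ => a ((n + k : ℕ) : ℤ) * z ^ (n + k)) (laurentSum a z) := by
  have h := (summable_disc hs (fun k hk => ha k (by omega)) hz).hasSum
  have hi : Function.Injective fun k : ℕ => ((n + k : ℕ) : ℤ) := fun i j hij => by
    simpa using hij
  rw [← hi.hasSum_iff] at h
  · exact h
  · intro k hk
    rw [ha k, zero_mul]
    by_contra! hc
    exact hk ⟨(k - n).toNat, by push_cast; omega⟩

theorem continuousOn_sphere_laurentSum {a : ℤ → ℂ} (hs : Summable a) :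
    ContinuousOn (laurentSum a) (Metric.sphere 0 1) :=
  continuousOn_tsum (fun _ => continuousOn_mul_zpow _ _) hs.norm fun k z hz => by
    simp [show ‖z‖ = 1 by simpa using hz]

/-- Dominated convergence: radii of at least 1/2 keep all arguments in a compact annulus, on which f
is bounded. The origin is left out because the lemma must also serve z ↦ Ψ_{-n}(1/z). -/
theorem tendsto_circleMean {f : ℂ → ℂ} (hf : ContinuousOn f {z | z ≠ 0 ∧ ‖z‖ ≤ 1}) (m : ℤ)
    {ρ : ℕ → ℝ} (hρ : Tendsto ρ atTop (𝓝 1)) (h0 : ∀ i, 1 / 2 ≤ ρ i) (h1 : ∀ i, ρ i < 1) :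
    Tendsto (fun i => fourierCoef (fun z => f (ρ i * z)) m) atTop (𝓝 (fourierCoef f m)) := by
  have hsub : Metric.closedBall (0 : ℂ) 1 \ Metric.ball 0 (1 / 2) ⊆ {z | z ≠ 0 ∧ ‖z‖ ≤ 1} := by
    rintro z ⟨ha, hb⟩
    refine ⟨?_, by simpa using ha⟩
    rintro rfl
    simp at hb
  have hK : IsCompact (Metric.closedBall (0 : ℂ) 1 \ Metric.ball 0 (1 / 2)) :=
    (isCompact_closedBall 0 1).diff Metric.isOpen_ball
  obtain ⟨M, hM⟩ := hK.exists_bound_of_continuousOn (hf.mono hsub)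
  have hc : ∀ θ : ℝ, ‖circleMap 0 1 θ‖ = 1 := fun θ => by simp
  have hn : ∀ i θ, ‖(ρ i : ℂ) * circleMap 0 1 θ‖ = ρ i := fun i θ => by
    rw [norm_mul, hc, mul_one, Complex.norm_of_nonneg (by linarith [h0 i])]
  have hmem : ∀ i θ, (ρ i : ℂ) * circleMap 0 1 θ ∈
      Metric.closedBall (0 : ℂ) 1 \ Metric.ball 0 (1 / 2) := fun i θ => by
    have a := h0 i
    have b := h1 i
    refine ⟨?_, ?_⟩
    · rw [mem_closedBall_zero_iff, hn]; exact b.le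
    · rw [mem_ball_zero_iff, hn]; exact not_lt.mpr a
  have hz : ∀ k : ℤ, Continuous fun θ : ℝ => (circleMap 0 1 θ) ^ k := fun k =>
    (continuous_circleMap 0 1).zpow₀ k fun θ => Or.inl (ne_zero_of_circle (hc θ))
  unfold fourierCoef circleMean
  refine Tendsto.const_mul _ ?_
  unfold circleIntegral
  refine intervalIntegral.tendsto_integral_filter_of_dominated_convergence (fun _ => M) ?_ ?_
    intervalIntegrable_const ?_
  · refine Eventually.of_forall fun i => Continuous.aestronglyMeasurable ?_
    have h2 : Continuous fun θ : ℝ => f (ρ i * circleMap 0 1 θ) :=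
      (hf.mono hsub).comp_continuous (continuous_const.mul (continuous_circleMap 0 1)) (hmem i)
    have h3 := hz (-1)
    simp only [zpow_neg_one] at h3
    simp only [deriv_circleMap, smul_eq_mul]
    exact ((continuous_circleMap 0 1).mul continuous_const).mul (h3.mul (h2.mul (hz (-m))))
  · refine Eventually.of_forall fun i => Eventually.of_forall fun θ _ => ?_
    simpa using hM _ (hmem i θ)
  · refine Eventually.of_forall fun θ _ => ?_
    refine Tendsto.const_smul (Tendsto.const_mul _ (Tendsto.mul_const _ ?_)) _
    have hw : Tendsto (fun i => (ρ i : ℂ) * circleMap 0 1 θ) atTop (𝓝 (circleMap 0 1 θ)) := by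
      have := ((Complex.continuous_ofReal.tendsto 1).comp hρ).mul_const (circleMap 0 1 θ)
      simpa using this
    have hmem1 : circleMap 0 1 θ ∈ {z : ℂ | z ≠ 0 ∧ ‖z‖ ≤ 1} :=
      ⟨ne_zero_of_circle (hc θ), (hc θ).le⟩
    exact (hf _ hmem1).tendsto.comp (tendsto_nhdsWithin_iff.mpr
      ⟨hw, Eventually.of_forall fun i => hsub (hmem i θ)⟩)

/-- The coefficients of a power series are the Fourier coefficients of its boundary values. -/
theorem coeff_eq_fourierCoef {f : ℂ → ℂ} {c : ℕ → ℂ} {n : ℕ}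
    (hf : ContinuousOn f {z | z ≠ 0 ∧ ‖z‖ ≤ 1})
    (hc : ∀ z, z ≠ 0 → ‖z‖ < 1 → HasSum (fun k : ℕ => c k * z ^ (n + k)) (f z)) (k : ℕ) :
    c k = fourierCoef f ((n + k : ℕ) : ℤ) := by
  -- Inside the disc the series converges absolutely, so on the circle of radius ρ it can be
  -- integrated term by term.
  have key : ∀ ρ : ℝ, 0 < ρ → ρ < 1 →
      fourierCoef (fun z => f (ρ * z)) ((n + k : ℕ) : ℤ) = c k * (ρ : ℂ) ^ (n + k) := by
    intro ρ h0 h1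
    have hρ : ((ρ : ℝ) : ℂ) ≠ 0 := by exact_mod_cast h0.ne'
    have hs := hc ρ hρ (by rwa [Complex.norm_of_nonneg h0.le])
    have h := hasSum_circleMean
      (F := fun (j : ℕ) z => c j * (ρ : ℂ) ^ (n + j) * z ^ ((j : ℤ) - k))
      (f := fun z => f (ρ * z) * z ^ (-((n + k : ℕ) : ℤ))) hs.summable.norm
      (fun j => continuousOn_mul_zpow _ _) (fun j z hz => by simp [hz])
      (fun z hz => by
        have hz0 := ne_zero_of_circle hz
        have h := (hc (ρ * z) (mul_ne_zero hρ hz0)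
          (by rw [norm_mul, hz, mul_one, Complex.norm_of_nonneg h0.le]; exact h1)).mul_right
            (z ^ (-((n + k : ℕ) : ℤ)))
        refine h.congr_fun fun j => ?_
        have : z ^ ((j : ℤ) - k) = z ^ (n + j) * z ^ (-((n + k : ℕ) : ℤ)) := by
          rw [← zpow_natCast, ← zpow_add₀ hz0]; congr 1; push_cast; ring
        rw [this, mul_pow]; ring)
    simp only [circleMean_const_mul, circleMean_zpow] at h
    refine h.unique ((hasSum_ite_eq k (c k * (ρ : ℂ) ^ (n + k))).congr_fun fun j => ?_)
    by_cases hj : j = k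
    · simp [hj]
    · simp [hj, sub_eq_zero]
  -- The radii start at exactly 1/2, the lower bound that `tendsto_circleMean` asks for.
  have hρ : Tendsto (fun i : ℕ => 1 - 1 / 2 * (1 / ((i : ℝ) + 1))) atTop (𝓝 1) := by
    have := ((tendsto_one_div_add_atTop_nhds_zero_nat (𝕜 := ℝ)).const_mul (1 / 2)).const_sub 1
    simpa only [mul_zero, sub_zero] using this
  have hpos : ∀ i : ℕ, 0 < 1 / ((i : ℝ) + 1) := fun i => by positivity
  have hle : ∀ i : ℕ, 1 / ((i : ℝ) + 1) ≤ 1 := fun i => by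
    rw [div_le_one (by positivity)]; linarith [i.cast_nonneg (α := ℝ)]
  have h2 := tendsto_circleMean hf ((n + k : ℕ) : ℤ) hρ (fun i => by linarith [hle i])
    (fun i => by linarith [hpos i])
  refine tendsto_nhds_unique ?_ h2
  have h3 : Tendsto (fun i : ℕ => c k * ((1 - 1 / 2 * (1 / ((i : ℝ) + 1)) : ℝ) : ℂ) ^ (n + k))
      atTop (𝓝 (c k * ((1 : ℝ) : ℂ) ^ (n + k))) :=
    (((Complex.continuous_ofReal.tendsto 1).comp hρ).pow _).const_mul _
  simp only [Complex.ofReal_one, one_pow, mul_one] at h3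
  refine h3.congr fun i => (key _ ?_ ?_).symm
  · linarith [hle i]
  · linarith [hpos i]

/-! ### Linear operations on Laurent series -/

theorem laurentSum_add {a b : ℤ → ℂ} {z : ℂ} (ha : Summable fun k => a k * z ^ k)
    (hb : Summable fun k => b k * z ^ k) :
    laurentSum (fun k => a k + b k) z = laurentSum a z + laurentSum b z := by
  unfold laurentSum
  rw [← ha.tsum_add hb]
  simp only [add_mul]

theorem laurentSum_const_mul (c : ℂ) (a : ℤ → ℂ) (z : ℂ) :
    laurentSum (fun k => c * a k) z = c * laurentSum a z := by
  unfold laurentSum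
  rw [← tsum_mul_left]
  simp only [mul_assoc]

theorem summable_const_mul_zpow {a : ℤ → ℂ} {z : ℂ} (c : ℂ)
    (h : Summable fun k => a k * z ^ k) : Summable fun k => c * a k * z ^ k := by
  simpa only [mul_assoc] using h.mul_left c

theorem laurentSum_shift (a : ℤ → ℂ) (n : ℤ) {z : ℂ} (hz : z ≠ 0) :
    laurentSum (fun k => a (k - n)) z = z ^ n * laurentSum a z := by
  unfold laurentSum
  rw [← tsum_mul_left, ← (Equiv.subRight n).tsum_eq fun k => z ^ n * (a k * z ^ k)]
  refine tsum_congr fun k => ?_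
  have : z ^ k = z ^ n * z ^ (k - n) := by rw [← zpow_add₀ hz]; congr 1; ring
  rw [Equiv.subRight_apply, this]; ring

theorem summable_shift_zpow {a : ℤ → ℂ} (n : ℤ) {z : ℂ} (hz : z ≠ 0)
    (h : Summable fun k => a k * z ^ k) : Summable fun k => a (k - n) * z ^ k := by
  have h2 := ((Equiv.subRight n).summable_iff.mpr h).mul_left (z ^ n)
  refine h2.congr fun k => ?_
  have : z ^ k = z ^ n * z ^ (k - n) := by rw [← zpow_add₀ hz]; congr 1; ring
  rw [Function.comp_apply, Equiv.subRight_apply, this]; ring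

theorem summable_shift {a : ℤ → ℂ} (n : ℤ) (h : Summable a) : Summable fun k => a (k - n) :=
  (Equiv.subRight n).summable_iff.mpr h

/-- Three terms, to match the three terms of Szegő's recurrence. -/
theorem laurentSum_comb {a b c : ℤ → ℂ} {α β γ : ℂ} {i j l : ℤ} {z : ℂ} (hz : z ≠ 0)
    (ha : Summable fun k => a k * z ^ k) (hb : Summable fun k => b k * z ^ k)
    (hc : Summable fun k => c k * z ^ k) :
    laurentSum (fun k => α * a (k - i) + (β * b (k - j) + γ * c (k - l))) z =
      α * (z ^ i * laurentSum a z) + (β * (z ^ j * laurentSum b z) +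
        γ * (z ^ l * laurentSum c z)) := by
  have sa := summable_const_mul_zpow α (summable_shift_zpow i hz ha)
  have sb := summable_const_mul_zpow β (summable_shift_zpow j hz hb)
  have sc := summable_const_mul_zpow γ (summable_shift_zpow l hz hc)
  rw [laurentSum_add sa (by simpa only [add_mul] using sb.add sc), laurentSum_add sb sc,
    laurentSum_const_mul, laurentSum_const_mul, laurentSum_const_mul, laurentSum_shift _ _ hz,
    laurentSum_shift _ _ hz, laurentSum_shift _ _ hz]

/-! ### Coefficient sequences of polynomials and moments -/

/-- The coefficient sequence of a polynomial, indexed by `ℤ`. -/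
def polySeq (p : ℂ[X]) (k : ℤ) : ℂ := if 0 ≤ k then p.coeff k.toNat else 0

theorem polySeq_natCast (p : ℂ[X]) (k : ℕ) : polySeq p k = p.coeff k := by simp [polySeq]

theorem polySeq_of_neg (p : ℂ[X]) {k : ℤ} (hk : k < 0) : polySeq p k = 0 := by
  simp [polySeq, hk]

theorem polySeq_of_gt (p : ℂ[X]) {n : ℕ} (hp : p.natDegree ≤ n) {k : ℤ} (hk : n < k) :
    polySeq p k = 0 := by
  unfold polySeq
  rw [if_pos (by omega), Polynomial.coeff_eq_zero_of_natDegree_lt]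
  omega

theorem hasSum_polySeq_mul (p : ℂ[X]) (g : ℤ → ℂ) :
    HasSum (fun k => polySeq p k * g k) (p.sum fun j c => c * g j) := by
  have hi : Function.Injective ((↑) : ℕ → ℤ) := Nat.cast_injective
  rw [← hi.hasSum_iff]
  · simp only [Function.comp_def, polySeq_natCast]
    rw [Polynomial.sum_def]
    refine hasSum_sum_of_ne_finset_zero fun k hk => ?_
    rw [Polynomial.notMem_support_iff.mp hk, zero_mul]
  · intro k hk
    rw [polySeq_of_neg, zero_mul]
    by_contra! hc
    exact hk ⟨k.toNat, by simp [hc]⟩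

theorem summable_polySeq (p : ℂ[X]) : Summable (polySeq p) := by
  simpa using (hasSum_polySeq_mul p fun _ => 1).summable

theorem laurentSum_polySeq (p : ℂ[X]) (z : ℂ) : laurentSum (polySeq p) z = p.eval z := by
  refine (hasSum_polySeq_mul p fun k => z ^ k).tsum_eq.trans ?_
  simp [Polynomial.eval_eq_sum]

/-- The pairing `∫_𝕋 f(ζ) q(ζ⁻¹) dζ / (2πiζ)` of a Laurent series `f` with coefficients `u` and a
polynomial `q`. -/
def pair (u : ℤ → ℂ) (q : ℂ[X]) : ℂ := q.sum fun j c => c * u j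

theorem pair_eq_conv (u : ℤ → ℂ) (q : ℂ[X]) : pair u q = conv u (reversed (polySeq q)) 0 := by
  unfold pair conv reversed
  rw [← (hasSum_polySeq_mul q u).tsum_eq]
  refine tsum_congr fun j => ?_
  simp [mul_comm]

theorem pair_eq_circleMean {u : ℤ → ℂ} (hu : Summable u) {f : ℂ → ℂ}
    (hf : ∀ z, ‖z‖ = 1 → f z = laurentSum u z) (q : ℂ[X]) :
    circleMean (fun z => f z * q.eval z⁻¹) = pair u q := by
  have hq := summable_reversed (summable_polySeq q)
  rw [pair_eq_conv, ← fourierCoef_of_eq (f := fun z => f z * q.eval z⁻¹) (summable_conv hu hq)]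
  · simp [fourierCoef]
  · intro z hz
    rw [laurentSum_conv_circle hu hq hz, laurentSum_reversed, laurentSum_polySeq, hf z hz]

theorem pair_eq_zero {u : ℤ → ℂ} {q : ℂ[X]} {n : ℕ} (hu : ∀ k : ℕ, k < n → u k = 0)
    (hq : q.natDegree < n) : pair u q = 0 :=
  Finset.sum_eq_zero fun j hj => by
    simp only [hu j ((Polynomial.le_natDegree_of_mem_supp j hj).trans_lt hq), mul_zero]

theorem pair_eq_single {u : ℤ → ℂ} {q : ℂ[X]} {n : ℕ} (hu : ∀ k : ℕ, k < n → u k = 0)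
    (hq : q.natDegree ≤ n) : pair u q = q.coeff n * u n := by
  unfold pair
  rw [Polynomial.sum_def]
  refine Finset.sum_eq_single n (fun j hj hjn => ?_) fun h => ?_
  · have := Polynomial.le_natDegree_of_mem_supp j hj
    rw [hu j (by omega), mul_zero]
  · rw [Polynomial.notMem_support_iff.mp h, zero_mul]

theorem conv_right_comm {a b c : ℤ → ℂ} (ha : Summable a) (hb : Summable b) (hc : Summable c) :
    conv (conv a b) c = conv (conv a c) b := by
  refine laurentSum_injective (summable_conv (summable_conv ha hb) hc)
    (summable_conv (summable_conv ha hc) hb) fun z hz => ?_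
  rw [laurentSum_conv_circle (summable_conv ha hb) hc hz, laurentSum_conv_circle ha hb hz,
    laurentSum_conv_circle (summable_conv ha hc) hb hz, laurentSum_conv_circle ha hc hz]
  ring

/-- The substitution ζ ↦ ζ⁻¹ in the mean. It makes the reflected system bi-orthonormal again. -/
theorem pair_symm {W : ℤ → ℂ} (hW : Summable W) (p q : ℂ[X]) :
    pair (conv (reversed W) (polySeq q)) p = pair (conv W (polySeq p)) q := by
  rw [pair_eq_conv, pair_eq_conv, conv_right_comm hW (summable_polySeq p)
    (summable_reversed (summable_polySeq q))]
  have h := congrFun (reversed_conv (conv W (reversed (polySeq q))) (polySeq p)) 0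
  conv_rhs at h => rw [reversed_conv, reversed_reversed]
  rw [← h]
  simp [reversed]

/-! ### Bi-orthogonality and Szegő's recurrence in terms of Fourier coefficients -/

/-- The Fourier coefficients of `w φ_n`. -/
def weighted (W : ℤ → ℂ) (φ : ℕ → ℂ[X]) (n : ℕ) : ℤ → ℂ := conv W (polySeq (φ n))

/-- A bi-orthonormal system in terms of the Fourier coefficients `W` of the weight. -/
structure IsOrtho (W : ℤ → ℂ) (φ φbar : ℕ → ℂ[X]) : Prop where
  summable : Summable W
  natDegree_left : ∀ n, (φ n).natDegree = n
  natDegree_right : ∀ n, (φbar n).natDegree = n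
  coeff_left : ∀ n, (φ n).coeff n = kappa φ n
  coeff_right : ∀ n, (φbar n).coeff n = kappa φ n
  orth : ∀ m n, pair (weighted W φ m) (φbar n) = if m = n then 1 else 0

variable {W p ip m im : ℤ → ℂ} {φ φbar : ℕ → ℂ[X]}

theorem IsOrtho.kappa_symm (h : IsOrtho W φ φbar) (n : ℕ) : kappa φbar n = kappa φ n := by
  rw [← h.coeff_right, kappa, Polynomial.leadingCoeff, h.natDegree_right]

theorem IsOrtho.symm (h : IsOrtho W φ φbar) : IsOrtho (reversed W) φbar φ where
  summable := summable_reversed h.summable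
  natDegree_left := h.natDegree_right
  natDegree_right := h.natDegree_left
  coeff_left n := by rw [h.kappa_symm, h.coeff_right]
  coeff_right n := by rw [h.kappa_symm, h.coeff_left]
  orth m n := by
    rw [weighted, pair_symm h.summable, ← weighted, h.orth]; simp [eq_comm]

/-- The polynomials φbar_0, …, φbar_k are triangular in the monomials. Once the lower moments
vanish, pairing with φbar_k leaves only its leading coefficient times the k-th moment. -/
theorem IsOrtho.weighted_eq_zero (h : IsOrtho W φ φbar) {n k : ℕ} (hk : k < n) :
    weighted W φ n k = 0 := by
  induction k using Nat.strong_induction_on with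
  | _ k ih =>
    have h1 := h.orth n k
    rw [if_neg hk.ne', pair_eq_single (n := k) (fun j hj => ih j hj (hj.trans hk))
      (h.natDegree_right k).le] at h1
    -- A vanishing leading coefficient would force φbar_k = 0, against its pairing with φ_k being 1.
    refine (mul_eq_zero.mp h1).resolve_left fun h0 => ?_
    have h2 := h.orth k k
    rw [if_pos rfl, pair] at h2
    have h3 : φbar k = 0 := by
      rw [← Polynomial.leadingCoeff_eq_zero, Polynomial.leadingCoeff, h.natDegree_right, h0]
    simp [h3] at h2

theorem IsOrtho.kappa_mul_weighted (h : IsOrtho W φ φbar) (n : ℕ) :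
    kappa φ n * weighted W φ n n = 1 := by
  have h1 := h.orth n n
  rwa [if_pos rfl, pair_eq_single (n := n) (fun j hj => h.weighted_eq_zero hj)
    (h.natDegree_right n).le, h.coeff_right] at h1

theorem IsOrtho.kappa_ne_zero (h : IsOrtho W φ φbar) (n : ℕ) : kappa φ n ≠ 0 :=
  left_ne_zero_of_mul_eq_one (h.kappa_mul_weighted n)

theorem IsOrtho.summable_weighted (h : IsOrtho W φ φbar) (n : ℕ) : Summable (weighted W φ n) :=
  summable_conv h.summable (summable_polySeq _)

/-- With d the degree of s, pairing with φbar_d gives zero by the moments. By symmetry it also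
equals the leading coefficient of s times a nonzero number. -/
theorem IsOrtho.eq_zero_of_moments (h : IsOrtho W φ φbar) {s : ℂ[X]} {n : ℕ}
    (hs : ∀ k : ℕ, k < n → conv W (polySeq s) k = 0) (hd : s.natDegree < n) : s = 0 := by
  have h1 : pair (conv W (polySeq s)) (φbar s.natDegree) = 0 :=
    pair_eq_zero hs (by rwa [h.natDegree_right])
  rw [← pair_symm h.summable, ← weighted, pair_eq_single (n := s.natDegree)
    (fun j hj => h.symm.weighted_eq_zero hj) le_rfl] at h1
  have h2 := h.symm.kappa_mul_weighted s.natDegree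
  exact Polynomial.leadingCoeff_eq_zero.mp
    ((mul_eq_zero.mp h1).resolve_right (right_ne_zero_of_mul_eq_one h2))

theorem eval_reflect (n : ℕ) {q : ℂ[X]} (hq : q.natDegree ≤ n) {z : ℂ} (hz : z ≠ 0) :
    (q.reflect n).eval z = z ^ n * q.eval z⁻¹ := by
  let _ : Invertible z⁻¹ := invertibleOfNonzero (inv_ne_zero hz)
  have h := Polynomial.eval₂_reflect_mul_pow (RingHom.id ℂ) z⁻¹ n q hq
  simp only [invOf_eq_inv, inv_inv, Polynomial.eval₂_id] at h
  rw [← h, inv_pow]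
  field_simp

theorem IsOrtho.laurentSum_weighted (h : IsOrtho W φ φbar) (n : ℕ) {z : ℂ} (hz : ‖z‖ = 1) :
    laurentSum (weighted W φ n) z = laurentSum W z * (φ n).eval z := by
  rw [weighted, laurentSum_conv_circle h.summable (summable_polySeq _) hz, laurentSum_polySeq]

theorem IsOrtho.laurentSum_weighted_symm (h : IsOrtho W φ φbar) (n : ℕ) {z : ℂ} (hz : ‖z‖ = 1) :
    laurentSum (reversed (weighted (reversed W) φbar n)) z = laurentSum W z * (φbar n).eval z⁻¹ := by
  rw [laurentSum_reversed, h.symm.laurentSum_weighted n (by simp [hz]), laurentSum_reversed,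
    inv_inv]

/-- Szegő's recurrence. -/
theorem IsOrtho.recurrence (h : IsOrtho W φ φbar) (n : ℕ) {z : ℂ} (hz : z ≠ 0) :
    kappa φ n * (φ (n + 1)).eval z =
      kappa φ (n + 1) * (z * (φ n).eval z) +
        (φ (n + 1)).eval 0 * (z ^ n * (φbar n).eval z⁻¹) := by
  -- The defect of the recurrence. Its constant term cancels because the reflected φbar_n has
  -- constant term κ_n, and its z^{n+1} term cancels by the choice of the κ's. So p is X times a
  -- polynomial of lower degree, which is to be killed by its moments.
  set p : ℂ[X] := C (kappa φ n) * φ (n + 1) -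
    (C (kappa φ (n + 1)) * (X * φ n) + C ((φ (n + 1)).eval 0) * (φbar n).reflect n) with hp
  have hev : ∀ z : ℂ, z ≠ 0 → p.eval z = kappa φ n * (φ (n + 1)).eval z -
      (kappa φ (n + 1) * (z * (φ n).eval z) +
        (φ (n + 1)).eval 0 * (z ^ n * (φbar n).eval z⁻¹)) := fun z hz => by
    simp [hp, eval_reflect n (h.natDegree_right n).le hz]
  suffices hp0 : p = 0 by
    have := hev z hz
    rw [hp0, Polynomial.eval_zero] at this
    exact (sub_eq_zero.mp this.symm)
  have hc0 : p.coeff 0 = 0 := by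
    have h3 : ((φbar n).reflect n).coeff 0 = kappa φ n := by
      rw [Polynomial.coeff_reflect, Polynomial.revAt_le (Nat.zero_le n), Nat.sub_zero,
        h.coeff_right]
    simp only [hp, Polynomial.coeff_sub, Polynomial.coeff_add, Polynomial.coeff_C_mul,
      Polynomial.coeff_X_mul_zero, h3, mul_zero, zero_add]
    rw [Polynomial.coeff_zero_eq_eval_zero]
    ring
  have hdeg : ∀ k, n < k → p.coeff k = 0 := by
    intro k hk
    obtain ⟨j, rfl⟩ : ∃ j, k = j + 1 := ⟨k - 1, by omega⟩
    have h3 : ((φbar n).reflect n).coeff (j + 1) = 0 := by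
      rw [Polynomial.coeff_reflect, Polynomial.revAt_eq_self_of_lt hk]
      exact Polynomial.coeff_eq_zero_of_natDegree_lt (by rwa [h.natDegree_right])
    simp only [hp, Polynomial.coeff_sub, Polynomial.coeff_add, Polynomial.coeff_C_mul,
      Polynomial.coeff_X_mul, h3, mul_zero, add_zero]
    rcases Nat.eq_or_lt_of_le (Nat.lt_succ_iff.mp hk) with e | e
    · rw [← e, h.coeff_left, h.coeff_left]; ring
    · rw [Polynomial.coeff_eq_zero_of_natDegree_lt (by rw [h.natDegree_left]; omega),
        Polynomial.coeff_eq_zero_of_natDegree_lt (by rwa [h.natDegree_left])]; ring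
  have hX : p = X * p.divX := by
    conv_lhs => rw [← Polynomial.divX_mul_X_add p, hc0]
    simp [mul_comm]
  have hu := h.summable_weighted n
  have hu1 := h.summable_weighted (n + 1)
  have hv := summable_reversed (h.symm.summable_weighted n)
  -- Division by X shifts the indices by one, so that for 0 ≤ k < n all three terms are evaluated
  -- inside their gaps of vanishing coefficients.
  have hseq : conv W (polySeq p.divX) = fun k => kappa φ n * weighted W φ (n + 1) (k - (-1)) +
      (-kappa φ (n + 1) * weighted W φ n (k - 0) +
        -(φ (n + 1)).eval 0 * reversed (weighted (reversed W) φbar n) (k - (n - 1))) := by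
    refine laurentSum_injective (summable_conv h.summable (summable_polySeq _))
      (((summable_shift _ hu1).mul_left _).add
        (((summable_shift _ hu).mul_left _).add ((summable_shift _ hv).mul_left _)))
      fun z hz => ?_
    have hz0 := ne_zero_of_circle hz
    have e := hev z hz0
    rw [hX, Polynomial.eval_mul, Polynomial.eval_X] at e
    rw [laurentSum_conv_circle h.summable (summable_polySeq _) hz, laurentSum_polySeq,
      laurentSum_comb hz0 (summable_mul_zpow hu1 hz) (summable_mul_zpow hu hz)
        (summable_mul_zpow hv hz), h.laurentSum_weighted _ hz,
      h.laurentSum_weighted _ hz, h.laurentSum_weighted_symm _ hz, zpow_neg_one, zpow_zero,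
      zpow_sub_one₀ hz0, zpow_natCast]
    have e2 : p.divX.eval z = z⁻¹ * (z * p.divX.eval z) := by field_simp
    rw [e2, e]
    field_simp
    ring
  -- For n = 0 the quotient by X cannot have degree below n, but then p is a constant with zero
  -- constant term.
  rcases Nat.eq_zero_or_pos n with hn | hn
  · ext k
    rcases Nat.eq_zero_or_pos k with hk | hk
    · rw [hk, hc0, Polynomial.coeff_zero]
    · rw [hdeg k (by omega), Polynomial.coeff_zero]
  rw [hX, h.eq_zero_of_moments (s := p.divX) (n := n), mul_zero]
  · intro k hk
    rw [hseq]
    have e1 := h.weighted_eq_zero (n := n + 1) (k := k + 1) (by omega)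
    have e2 := h.weighted_eq_zero hk
    have e3 := h.symm.weighted_eq_zero (n := n) (k := n - (k + 1)) (by omega)
    have i1 : (k : ℤ) - (-1) = ((k + 1 : ℕ) : ℤ) := by push_cast; ring
    have i3 : -((k : ℤ) - (n - 1)) = ((n - (k + 1) : ℕ) : ℤ) := by omega
    simp only [i1, sub_zero, reversed, i3, e1, e2, e3, mul_zero, add_zero]
  · have := (Polynomial.natDegree_le_iff_coeff_eq_zero (p := p) (n := n)).mpr hdeg
    rw [Polynomial.natDegree_divX_eq_natDegree_tsub_one]
    omega

theorem IsOrtho.weighted_succ (h : IsOrtho W φ φbar) (n : ℕ) (k : ℤ) :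
    kappa φ n * weighted W φ (n + 1) k = kappa φ (n + 1) * weighted W φ n (k - 1) +
      (φ (n + 1)).eval 0 * weighted (reversed W) φbar n (n - k) := by
  have hu := h.summable_weighted n
  have hu1 := h.summable_weighted (n + 1)
  have hv := summable_reversed (h.symm.summable_weighted n)
  have e : (fun k => kappa φ n * weighted W φ (n + 1) (k - 0) +
      (-kappa φ (n + 1) * weighted W φ n (k - 1) +
        -(φ (n + 1)).eval 0 * reversed (weighted (reversed W) φbar n) (k - n))) = fun _ => 0 := by
    refine laurentSum_injective (((summable_shift _ hu1).mul_left _).add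
      (((summable_shift _ hu).mul_left _).add ((summable_shift _ hv).mul_left _)))
      summable_zero fun z hz => ?_
    have hz0 := ne_zero_of_circle hz
    rw [laurentSum_comb hz0 (summable_mul_zpow hu1 hz) (summable_mul_zpow hu hz)
        (summable_mul_zpow hv hz), h.laurentSum_weighted _ hz,
      h.laurentSum_weighted _ hz, h.laurentSum_weighted_symm _ hz, zpow_one, zpow_zero,
      zpow_natCast]
    have e0 : laurentSum (fun _ => 0) z = 0 := by simp [laurentSum]
    rw [e0]
    linear_combination laurentSum W z * h.recurrence n hz0
  have e2 := congrFun e k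
  simp only [sub_zero, reversed, neg_sub] at e2
  linear_combination e2

/-! ### Wiener–Hopf factorisations and the scattering sequences -/

/-- A Wiener–Hopf factorisation `w = w₊ w₋` with absolutely summable coefficients: `p`, `ip` are
the coefficients of `w₊`, `1 / w₊` and `m`, `im` are those of `w₋`, `1 / w₋`. -/
structure IsWienerHopf (W p ip m im : ℤ → ℂ) : Prop where
  summable_p : Summable p
  summable_ip : Summable ip
  summable_m : Summable m
  summable_im : Summable im
  p_neg : ∀ k < 0, p k = 0
  ip_neg : ∀ k < 0, ip k = 0
  m_pos : ∀ k > 0, m k = 0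
  im_pos : ∀ k > 0, im k = 0
  p_mul_ip : ∀ z, ‖z‖ = 1 → laurentSum p z * laurentSum ip z = 1
  m_mul_im : ∀ z, ‖z‖ = 1 → laurentSum m z * laurentSum im z = 1
  p_mul_m : ∀ z, ‖z‖ = 1 → laurentSum p z * laurentSum m z = laurentSum W z

theorem IsWienerHopf.symm (h : IsWienerHopf W p ip m im) :
    IsWienerHopf (reversed W) (reversed m) (reversed im) (reversed p) (reversed ip) where
  summable_p := summable_reversed h.summable_m
  summable_ip := summable_reversed h.summable_im
  summable_m := summable_reversed h.summable_p
  summable_im := summable_reversed h.summable_ip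
  p_neg k hk := h.m_pos (-k) (by omega)
  ip_neg k hk := h.im_pos (-k) (by omega)
  m_pos k hk := h.p_neg (-k) (by omega)
  im_pos k hk := h.ip_neg (-k) (by omega)
  p_mul_ip z hz := by simpa only [laurentSum_reversed] using h.m_mul_im z⁻¹ (by simp [hz])
  m_mul_im z hz := by simpa only [laurentSum_reversed] using h.p_mul_ip z⁻¹ (by simp [hz])
  p_mul_m z hz := by
    simpa only [laurentSum_reversed, mul_comm] using h.p_mul_m z⁻¹ (by simp [hz])

/-- The coefficients of `φ_{+n}`: the part of `w φ_n` with nonnegative indices, over `w₊`. -/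
def waveSeq (W : ℤ → ℂ) (φ : ℕ → ℂ[X]) (ip : ℤ → ℂ) (n : ℕ) : ℤ → ℂ :=
  conv (restr {k | 0 ≤ k} (weighted W φ n)) ip

/-- The coefficients of `φhat_{-n}`: the part of `w φ_n` with negative indices, over `w₋`. -/
def tailSeq (W : ℤ → ℂ) (φ : ℕ → ℂ[X]) (im : ℤ → ℂ) (n : ℕ) : ℤ → ℂ :=
  conv (restr {k | k < 0} (weighted W φ n)) im

theorem summable_waveSeq (h : IsOrtho W φ φbar) (hf : IsWienerHopf W p ip m im) (n : ℕ) :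
    Summable (waveSeq W φ ip n) :=
  summable_conv (summable_restr (h.summable_weighted n) _) hf.summable_ip

theorem summable_tailSeq (h : IsOrtho W φ φbar) (hf : IsWienerHopf W p ip m im) (n : ℕ) :
    Summable (tailSeq W φ im n) :=
  summable_conv (summable_restr (h.summable_weighted n) _) hf.summable_im

theorem IsOrtho.restr_weighted_eq_zero (h : IsOrtho W φ φbar) {n : ℕ} {k : ℤ} (hk : k < n) :
    restr {k | 0 ≤ k} (weighted W φ n) k = 0 := by
  rcases lt_or_ge k 0 with h0 | h0
  · exact restr_of_notMem _ (by simpa using h0)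
  · rw [restr_of_mem (s := {k | 0 ≤ k}) _ h0]
    lift k to ℕ using h0
    exact h.weighted_eq_zero (by exact_mod_cast hk)

theorem waveSeq_eq_zero (h : IsOrtho W φ φbar) (hf : IsWienerHopf W p ip m im) {n : ℕ} {k : ℤ}
    (hk : k < n) : waveSeq W φ ip n k = 0 :=
  conv_eq_zero_of_lt (fun _ hj => h.restr_weighted_eq_zero hj) hf.ip_neg hk

theorem waveSeq_self (h : IsOrtho W φ φbar) (hf : IsWienerHopf W p ip m im) (n : ℕ) :
    kappa φ n * waveSeq W φ ip n n = ip 0 := by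
  rw [waveSeq, conv_eq_mul_of_le (fun _ hj => h.restr_weighted_eq_zero hj) hf.ip_neg,
    restr_of_mem _ (by simp), ← mul_assoc, h.kappa_mul_weighted, one_mul]

theorem tailSeq_eq_zero (hf : IsWienerHopf W p ip m im) {n : ℕ} {k : ℤ}
    (hk : 0 ≤ k) : tailSeq W φ im n k = 0 :=
  conv_eq_zero_of_gt (n := -1) (fun _ hj => restr_of_notMem _ (by simp; omega))
    hf.im_pos (by omega)

theorem restr_add_restr_compl (a : ℤ → ℂ) :
    (fun k => restr {k | 0 ≤ k} a k + restr {k | k < 0} a k) = a := by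
  funext k
  rcases lt_or_ge k 0 with h0 | h0
  · rw [restr_of_notMem (s := {k | 0 ≤ k}) _ (not_le.mpr h0),
      restr_of_mem (s := {k | k < 0}) _ h0, zero_add]
  · rw [restr_of_mem (s := {k | 0 ≤ k}) _ h0,
      restr_of_notMem (s := {k | k < 0}) _ (not_lt.mpr h0), add_zero]

/-- `w φ_n = w₊ φ_{+n} + w₋ φhat_{-n}` on the circle. -/
theorem laurentSum_weighted_eq (h : IsOrtho W φ φbar) (hf : IsWienerHopf W p ip m im) (n : ℕ)
    {z : ℂ} (hz : ‖z‖ = 1) :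
    laurentSum p z * laurentSum m z * (φ n).eval z =
      laurentSum p z * laurentSum (waveSeq W φ ip n) z +
        laurentSum m z * laurentSum (tailSeq W φ im n) z := by
  have hu := h.summable_weighted n
  have e : laurentSum (weighted W φ n) z = laurentSum (restr {k | 0 ≤ k} (weighted W φ n)) z +
      laurentSum (restr {k | k < 0} (weighted W φ n)) z := by
    rw [← laurentSum_add (summable_mul_zpow (summable_restr hu _) hz)
      (summable_mul_zpow (summable_restr hu _) hz), restr_add_restr_compl]
  rw [hf.p_mul_m z hz, ← h.laurentSum_weighted n hz, e, waveSeq, tailSeq,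
    laurentSum_conv_circle (summable_restr hu _) hf.summable_ip hz,
    laurentSum_conv_circle (summable_restr hu _) hf.summable_im hz]
  linear_combination -laurentSum (restr {k | 0 ≤ k} (weighted W φ n)) z * hf.p_mul_ip z hz -
    laurentSum (restr {k | k < 0} (weighted W φ n)) z * hf.m_mul_im z hz

/-- `φ_n = φ_{+n} / w₋ + φhat_{-n} / w₊` on the circle. -/
theorem eval_eq_add (h : IsOrtho W φ φbar) (hf : IsWienerHopf W p ip m im) (n : ℕ)
    {z : ℂ} (hz : ‖z‖ = 1) :
    (φ n).eval z = laurentSum im z * laurentSum (waveSeq W φ ip n) z +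
      laurentSum ip z * laurentSum (tailSeq W φ im n) z := by
  have e := laurentSum_weighted_eq h hf n hz
  have e1 := hf.p_mul_ip z hz
  have e2 := hf.m_mul_im z hz
  generalize laurentSum p z = P at *
  generalize laurentSum m z = M at *
  generalize laurentSum ip z = P' at *
  generalize laurentSum im z = M' at *
  generalize laurentSum (waveSeq W φ ip n) z = x at *
  generalize laurentSum (tailSeq W φ im n) z = y at *
  have h1 : P * P' * (M * M') * (φ n).eval z = P * P' * (M' * x) + M * M' * (P' * y) := by
    linear_combination P' * M' * e
  rw [e1, e2] at h1
  linear_combination h1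

/-- This is `eval_eq_add` times w₋. The factor w₋/w₊ that appears is 1/S. -/
theorem conv_polySeq_m (h : IsOrtho W φ φbar) (hf : IsWienerHopf W p ip m im) (n : ℕ) (k : ℤ) :
    conv (polySeq (φ n)) m k =
      waveSeq W φ ip n k + conv (tailSeq W φ im n) (conv m ip) k := by
  have hx := summable_waveSeq h hf n
  have hy := summable_tailSeq h hf n
  have hmi := summable_conv hf.summable_m hf.summable_ip
  refine congrFun (laurentSum_injective (b := fun k => waveSeq W φ ip n k +
    conv (tailSeq W φ im n) (conv m ip) k) (summable_conv (summable_polySeq _) hf.summable_m)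
    (hx.add (summable_conv hy hmi)) fun z hz => ?_) k
  rw [laurentSum_conv_circle (summable_polySeq _) hf.summable_m hz, laurentSum_polySeq,
    laurentSum_add (summable_mul_zpow hx hz) (summable_mul_zpow (summable_conv hy hmi) hz),
    laurentSum_conv_circle hy hmi hz, laurentSum_conv_circle hf.summable_m hf.summable_ip hz,
    eval_eq_add h hf n hz]
  linear_combination laurentSum (waveSeq W φ ip n) z * hf.m_mul_im z hz

/-- This is `eval_eq_add` times w₊. The factor w₊/w₋ that appears is S. -/
theorem conv_polySeq_p (h : IsOrtho W φ φbar) (hf : IsWienerHopf W p ip m im) (n : ℕ) (k : ℤ) :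
    conv (polySeq (φ n)) p k =
      conv (waveSeq W φ ip n) (conv p im) k + tailSeq W φ im n k := by
  have hx := summable_waveSeq h hf n
  have hy := summable_tailSeq h hf n
  have hmi := summable_conv hf.summable_p hf.summable_im
  refine congrFun (laurentSum_injective (b := fun k => conv (waveSeq W φ ip n) (conv p im) k +
    tailSeq W φ im n k) (summable_conv (summable_polySeq _) hf.summable_p)
    ((summable_conv hx hmi).add hy) fun z hz => ?_) k
  rw [laurentSum_conv_circle (summable_polySeq _) hf.summable_p hz, laurentSum_polySeq,
    laurentSum_add (summable_mul_zpow (summable_conv hx hmi) hz) (summable_mul_zpow hy hz),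
    laurentSum_conv_circle hx hmi hz, laurentSum_conv_circle hf.summable_p hf.summable_im hz,
    eval_eq_add h hf n hz]
  linear_combination laurentSum (tailSeq W φ im n) z * hf.p_mul_ip z hz

/-- The first Marchenko relation. -/
theorem marchenko_wave (h : IsOrtho W φ φbar) (hf : IsWienerHopf W p ip m im) {n : ℕ} {k : ℤ}
    (hk : n ≤ k) : kappa φ n * m 0 * (if k = n then 1 else 0) =
      waveSeq W φ ip n k + conv (tailSeq W φ im n) (conv m ip) k := by
  -- Neither φ_n nor w₋ contributes an index above n, and the coefficient at n is κ_n times that of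
  -- w₋ at 0.
  rw [← conv_polySeq_m h hf]
  have h0 : ∀ j : ℤ, j > n → polySeq (φ n) j = 0 := fun j hj =>
    polySeq_of_gt _ (h.natDegree_left n).le hj
  split_ifs with hkn
  · rw [hkn, conv_eq_mul_of_ge h0 hf.m_pos, polySeq_natCast, h.coeff_left, mul_one]
  · rw [conv_eq_zero_of_gt h0 hf.m_pos (by omega), mul_zero]

/-- The second Marchenko relation. -/
theorem marchenko_tail (h : IsOrtho W φ φbar) (hf : IsWienerHopf W p ip m im) {n : ℕ} {k : ℤ}
    (hk : k < 0) : 0 = conv (waveSeq W φ ip n) (conv p im) k + tailSeq W φ im n k := by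
  rw [← conv_polySeq_p h hf, conv_eq_zero_of_lt (n := 0) (fun j hj => polySeq_of_neg _ hj)
    hf.p_neg hk]

/-! ### The recurrence for the scattering sequences -/

/-- The coefficients of `φhat_{+n}`, from those of the reflected weight. -/
def coSeq (W : ℤ → ℂ) (φbar : ℕ → ℂ[X]) (ip : ℤ → ℂ) (n : ℕ) : ℤ → ℂ :=
  reversed (tailSeq (reversed W) φbar (reversed ip) n)

/-- The part of the coefficients of `w(z) φbar_n(1/z)` with positive indices. -/
def coWeighted (W : ℤ → ℂ) (φbar : ℕ → ℂ[X]) (n : ℕ) : ℤ → ℂ :=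
  reversed (restr {k | k < 0} (weighted (reversed W) φbar n))

theorem coWeighted_of_pos (W : ℤ → ℂ) (φbar : ℕ → ℂ[X]) (n : ℕ) {k : ℤ} (hk : 0 < k) :
    coWeighted W φbar n k = weighted (reversed W) φbar n (-k) := restr_of_mem _ (by simpa using hk)

theorem coWeighted_of_nonpos (W : ℤ → ℂ) (φbar : ℕ → ℂ[X]) (n : ℕ) {k : ℤ} (hk : k ≤ 0) :
    coWeighted W φbar n k = 0 := restr_of_notMem _ (by simpa using hk)

theorem coSeq_eq_conv (W : ℤ → ℂ) (φbar : ℕ → ℂ[X]) (ip : ℤ → ℂ) (n : ℕ) :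
    coSeq W φbar ip n = conv (coWeighted W φbar n) ip := by
  rw [coSeq, tailSeq, reversed_conv, reversed_reversed, coWeighted]

theorem IsOrtho.weighted_int_eq_zero (h : IsOrtho W φ φbar) {n : ℕ} {k : ℤ} (h0 : 0 ≤ k)
    (hk : k < n) : weighted W φ n k = 0 := by
  lift k to ℕ using h0
  exact h.weighted_eq_zero (by exact_mod_cast hk)

/-- The projection commutes with the shifts in the recurrence because every coefficient that would
cross the cut lies in a gap of vanishing moments. -/
theorem restr_weighted_succ (h : IsOrtho W φ φbar) (n : ℕ) (k : ℤ) :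
    kappa φ n * restr {k | 0 ≤ k} (weighted W φ (n + 1)) k =
      kappa φ (n + 1) * restr {k | 0 ≤ k} (weighted W φ n) (k - 1) +
        (φ (n + 1)).eval 0 * coWeighted W φbar n (k - n) := by
  rcases lt_or_ge 0 k with hk | hk
  · rw [restr_of_mem _ (by simpa using hk.le), restr_of_mem _ (by simp; omega),
      h.weighted_succ]
    congr 2
    rcases lt_or_ge (n : ℤ) k with hn | hn
    · rw [coWeighted_of_pos _ _ _ (by omega)]
      congr 1; ring
    · rw [coWeighted_of_nonpos _ _ _ (by omega), h.symm.weighted_int_eq_zero] <;> omega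
  · rw [h.restr_weighted_eq_zero (by push_cast; omega), coWeighted_of_nonpos _ _ _ (by omega),
      restr_of_notMem _ (by simp; omega)]
    simp

theorem coWeighted_succ (h : IsOrtho W φ φbar) (n : ℕ) (k : ℤ) :
    kappa φ n * coWeighted W φbar (n + 1) k =
      (φbar (n + 1)).eval 0 * restr {k | 0 ≤ k} (weighted W φ n) (k + n) +
        kappa φ (n + 1) * coWeighted W φbar n (k + 1) := by
  have key := h.symm.weighted_succ n (-k)
  rw [reversed_reversed, h.kappa_symm, h.kappa_symm] at key
  rcases lt_or_ge k 0 with hk | hk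
  · rw [h.restr_weighted_eq_zero (by omega), coWeighted_of_nonpos _ _ _ (by omega),
      coWeighted_of_nonpos _ _ _ (by omega)]
    simp
  · have e : kappa φ n * coWeighted W φbar (n + 1) k =
        kappa φ n * weighted (reversed W) φbar (n + 1) (-k) := by
      rcases eq_or_lt_of_le hk with h0 | h0
      · rw [coWeighted_of_nonpos _ _ _ (by omega), h.symm.weighted_int_eq_zero] <;> omega
      · rw [coWeighted_of_pos _ _ _ h0]
    rw [e, key, coWeighted_of_pos _ _ _ (by omega), restr_of_mem _ (by simp; omega),
      show -k - 1 = -(k + 1) by ring, show (n : ℤ) - -k = k + n by ring]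
    ring

theorem summable_coWeighted (h : IsOrtho W φ φbar) (n : ℕ) : Summable (coWeighted W φbar n) :=
  summable_reversed (summable_restr (h.symm.summable_weighted n) _)

theorem summable_coSeq (h : IsOrtho W φ φbar) (hf : IsWienerHopf W p ip m im) (n : ℕ) :
    Summable (coSeq W φbar ip n) := summable_reversed (summable_tailSeq h.symm hf.symm n)

theorem coSeq_eq_zero (hf : IsWienerHopf W p ip m im) {n : ℕ} {k : ℤ} (hk : k ≤ 0) :
    coSeq W φbar ip n k = 0 := tailSeq_eq_zero hf.symm (by omega)

/-- The projected coefficients obey the recurrence, and the factor 1/w₊ does not depend on n. All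
series involved are power series, so the identity holds on the whole punctured closed disc. -/
theorem wave_recurrence (h : IsOrtho W φ φbar) (hf : IsWienerHopf W p ip m im) (n : ℕ) {z : ℂ}
    (hz0 : z ≠ 0) (hz : ‖z‖ ≤ 1) :
    kappa φ n * laurentSum (waveSeq W φ ip (n + 1)) z =
        kappa φ (n + 1) * (z * laurentSum (waveSeq W φ ip n) z) +
          (φ (n + 1)).eval 0 * (z ^ n * laurentSum (coSeq W φbar ip n) z) ∧
      kappa φ n * laurentSum (coSeq W φbar ip (n + 1)) z =
        (φbar (n + 1)).eval 0 * ((z ^ n)⁻¹ * laurentSum (waveSeq W φ ip n) z) +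
          kappa φ (n + 1) * (z⁻¹ * laurentSum (coSeq W φbar ip n) z) := by
  have su : ∀ n, Summable fun k => restr {k | 0 ≤ k} (weighted W φ n) k * z ^ k := fun n =>
    summable_disc (summable_restr (h.summable_weighted n) _)
      (fun k hk => h.restr_weighted_eq_zero (by omega)) hz
  have sv : ∀ n, Summable fun k => coWeighted W φbar n k * z ^ k := fun n =>
    summable_disc (summable_coWeighted h n) (fun k hk => coWeighted_of_nonpos _ _ _ hk.le) hz
  have si := summable_disc hf.summable_ip hf.ip_neg hz
  simp only [coSeq_eq_conv, waveSeq, laurentSum_conv hz0 (su _) si, laurentSum_conv hz0 (sv _) si]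
  constructor
  · have e1 : kappa φ n * laurentSum (restr {k | 0 ≤ k} (weighted W φ (n + 1))) z =
        kappa φ (n + 1) * (z * laurentSum (restr {k | 0 ≤ k} (weighted W φ n)) z) +
          (φ (n + 1)).eval 0 * (z ^ n * laurentSum (coWeighted W φbar n) z) := by
      rw [← laurentSum_const_mul]
      simp only [restr_weighted_succ h]
      rw [laurentSum_add (summable_const_mul_zpow _ (summable_shift_zpow _ hz0 (su n)))
          (summable_const_mul_zpow _ (summable_shift_zpow _ hz0 (sv n))), laurentSum_const_mul,
        laurentSum_const_mul, laurentSum_shift _ _ hz0, laurentSum_shift _ _ hz0, zpow_one,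
        zpow_natCast]
    linear_combination laurentSum ip z * e1
  · have e : ∀ k, kappa φ n * coWeighted W φbar (n + 1) k =
        (φbar (n + 1)).eval 0 * restr {k | 0 ≤ k} (weighted W φ n) (k - (-(n : ℤ))) +
        kappa φ (n + 1) * coWeighted W φbar n (k - (-1)) := fun k => by
      rw [sub_neg_eq_add, sub_neg_eq_add, coWeighted_succ h]
    have e1 : kappa φ n * laurentSum (coWeighted W φbar (n + 1)) z =
        (φbar (n + 1)).eval 0 *
            ((z ^ n)⁻¹ * laurentSum (restr {k | 0 ≤ k} (weighted W φ n)) z) +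
          kappa φ (n + 1) * (z⁻¹ * laurentSum (coWeighted W φbar n) z) := by
      rw [← laurentSum_const_mul]
      simp only [e]
      rw [laurentSum_add (summable_const_mul_zpow _ (summable_shift_zpow _ hz0 (su n)))
          (summable_const_mul_zpow _ (summable_shift_zpow _ hz0 (sv n))), laurentSum_const_mul,
        laurentSum_const_mul, laurentSum_shift _ _ hz0, laurentSum_shift _ _ hz0, zpow_neg_one,
        zpow_neg, zpow_natCast]
    linear_combination laurentSum ip z * e1

/-! ### Asymptotics of the scattering sequences -/

/-- A sequence on negative indices reaches k only through entries of b beyond k. The coupling in the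
Marchenko relation is thus a far tail, small for large n. -/
theorem conv_restr_of_neg {a b : ℤ → ℂ} {n k : ℤ} (ha : ∀ j ≥ 0, a j = 0)
    (hk : n ≤ k) : conv a b k = conv a (restr {k | n < k} b) k := by
  unfold conv
  refine tsum_congr fun j => ?_
  rcases lt_or_ge j 0 with hj | hj
  · rw [restr_of_mem _ (by simp; omega)]
  · simp [ha j hj]

theorem conv_restr_of_ge {a b : ℤ → ℂ} {n k : ℤ} (ha : ∀ j < n, a j = 0)
    (hk : k < 0) : conv a b k = conv a (restr {k | k < -n} b) k := by
  unfold conv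
  refine tsum_congr fun j => ?_
  rcases lt_or_ge j n with hj | hj
  · simp [ha j hj]
  · rw [restr_of_mem _ (by simp; omega)]

theorem tendsto_l1_restr {b : ℤ → ℂ} (hb : Summable b) {s : ℕ → Set ℤ}
    (hs : ∀ k, ∀ᶠ n in atTop, k ∉ s n) :
    Tendsto (fun n => l1 (restr (s n) b)) atTop (𝓝 0) := by
  have h := tendsto_tsum_of_dominated_convergence (𝓕 := atTop)
    (f := fun n k => ‖restr (s n) b k‖) (g := fun _ => 0) hb.norm
    (fun k => tendsto_const_nhds.congr' ((hs k).mono fun n hn => by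
      simp only [restr_of_notMem _ hn, norm_zero]))
    (Eventually.of_forall fun n k => by
      rw [norm_norm]; exact norm_restr_le _ _ _)
  rw [tsum_zero] at h
  exact h

/-- The second Marchenko relation read as an estimate. -/
theorem l1_tailSeq_le (h : IsOrtho W φ φbar) (hf : IsWienerHopf W p ip m im) (n : ℕ) :
    l1 (tailSeq W φ im n) ≤
      l1 (waveSeq W φ ip n) * l1 (restr {k | k < -(n : ℤ)} (conv p im)) := by
  have hx := summable_waveSeq h hf n
  have hr := summable_restr (summable_conv hf.summable_p hf.summable_im) {k | k < -(n : ℤ)}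
  refine (l1_mono (summable_conv hx hr) fun k => ?_).trans (l1_conv_le hx hr)
  rcases lt_or_ge k 0 with hk | hk
  · have e := marchenko_tail h hf (n := n) hk
    rw [conv_restr_of_ge (fun j hj => waveSeq_eq_zero h hf hj) hk] at e
    rw [eq_neg_of_add_eq_zero_right e.symm, norm_neg]
  · rw [tailSeq_eq_zero hf hk, norm_zero]
    exact norm_nonneg _

/-- The first Marchenko relation off the diagonal, where its left side is zero. -/
theorem l1_waveSeq_sub_le (h : IsOrtho W φ φbar) (hf : IsWienerHopf W p ip m im) (n : ℕ) :
    l1 (restr {k | k ≠ n} (waveSeq W φ ip n)) ≤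
      l1 (tailSeq W φ im n) * l1 (restr {k | (n : ℤ) < k} (conv m ip)) := by
  have hy := summable_tailSeq h hf n
  have hr := summable_restr (summable_conv hf.summable_m hf.summable_ip) {k | (n : ℤ) < k}
  refine (l1_mono (summable_conv hy hr) fun k => ?_).trans (l1_conv_le hy hr)
  rcases lt_trichotomy k n with hk | hk | hk
  · rw [restr_of_mem _ hk.ne, waveSeq_eq_zero h hf hk, norm_zero]
    exact norm_nonneg _
  · rw [restr_of_notMem _ (by simpa using hk), norm_zero]
    exact norm_nonneg _
  · have e := marchenko_wave h hf hk.le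
    rw [if_neg hk.ne', mul_zero,
      conv_restr_of_neg (fun j hj => tailSeq_eq_zero hf hj) hk.le] at e
    rw [restr_of_mem _ hk.ne', eq_neg_of_add_eq_zero_left e.symm, norm_neg]

theorem norm_kappa_sub_le (h : IsOrtho W φ φbar) (hf : IsWienerHopf W p ip m im) (n : ℕ) :
    ‖kappa φ n * m 0 - waveSeq W φ ip n n‖ ≤
      l1 (tailSeq W φ im n) * l1 (restr {k | (n : ℤ) < k} (conv m ip)) := by
  have hy := summable_tailSeq h hf n
  have hr := summable_restr (summable_conv hf.summable_m hf.summable_ip) {k | (n : ℤ) < k}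
  have e := marchenko_wave h hf (n := n) le_rfl
  rw [if_pos rfl, mul_one, conv_restr_of_neg (fun j hj => tailSeq_eq_zero hf hj) le_rfl] at e
  rw [e, add_sub_cancel_left]
  exact (norm_le_l1 (summable_conv hy hr) _).trans (l1_conv_le hy hr)

theorem l1_waveSeq_le (h : IsOrtho W φ φbar) (hf : IsWienerHopf W p ip m im) (n : ℕ) :
    l1 (waveSeq W φ ip n) ≤
      ‖waveSeq W φ ip n n‖ + l1 (restr {k | k ≠ n} (waveSeq W φ ip n)) := by
  have hx := summable_waveSeq h hf n
  unfold l1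
  rw [hx.norm.tsum_eq_add_tsum_ite (n : ℤ)]
  refine le_of_eq ?_
  congr 2
  funext k
  split_ifs with hk
  · rw [restr_of_notMem _ (by simpa using hk), norm_zero]
  · rw [restr_of_mem _ hk]

theorem IsWienerHopf.p_zero_mul (hf : IsWienerHopf W p ip m im) : p 0 * ip 0 = 1 := by
  rw [← conv_eq_mul_of_le hf.p_neg hf.ip_neg]
  have e : conv p ip = polySeq 1 := laurentSum_injective
    (summable_conv hf.summable_p hf.summable_ip) (summable_polySeq 1) fun z hz => by
      rw [laurentSum_conv_circle hf.summable_p hf.summable_ip hz, hf.p_mul_ip z hz,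
        laurentSum_polySeq, Polynomial.eval_one]
  rw [e]
  simp [polySeq]

theorem IsWienerHopf.m_zero_mul (hf : IsWienerHopf W p ip m im) : m 0 * im 0 = 1 := by
  simpa [reversed] using hf.symm.p_zero_mul

theorem tendsto_tail_right (hf : IsWienerHopf W p ip m im) :
    Tendsto (fun n : ℕ => l1 (restr {k | (n : ℤ) < k} (conv m ip))) atTop (𝓝 0) :=
  tendsto_l1_restr (summable_conv hf.summable_m hf.summable_ip) fun k =>
    (eventually_ge_atTop k.toNat).mono fun n hn => by simp; omega

theorem tendsto_tail_left (hf : IsWienerHopf W p ip m im) :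
    Tendsto (fun n : ℕ => l1 (restr {k | k < -(n : ℤ)} (conv p im))) atTop (𝓝 0) :=
  tendsto_l1_restr (summable_conv hf.summable_p hf.summable_im) fun k =>
    (eventually_ge_atTop (-k).toNat).mono fun n hn => by simp; omega

/-- Absorption: the two estimates combined bound the off-diagonal part by half of the whole norm. -/
theorem eventually_l1_waveSeq_le (h : IsOrtho W φ φbar) (hf : IsWienerHopf W p ip m im) :
    ∀ᶠ n : ℕ in atTop, l1 (waveSeq W φ ip n) ≤ 2 * ‖waveSeq W φ ip n n‖ := by
  have ht := (tendsto_tail_left hf).mul (tendsto_tail_right hf)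
  rw [mul_zero] at ht
  filter_upwards [ht.eventually (eventually_le_nhds (show (0 : ℝ) < 1 / 2 by norm_num))]
    with n hn
  have h1 := l1_waveSeq_le h hf n
  have h2 := l1_waveSeq_sub_le h hf n
  have h3 := mul_le_mul_of_nonneg_right (l1_tailSeq_le h hf n)
    (l1_nonneg (restr {k | (n : ℤ) < k} (conv m ip)))
  have h4 := mul_le_mul_of_nonneg_left hn (l1_nonneg (waveSeq W φ ip n))
  rw [← mul_assoc] at h4
  linarith

theorem waveSeq_self_eq (h : IsOrtho W φ φbar) (hf : IsWienerHopf W p ip m im) (n : ℕ) :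
    waveSeq W φ ip n n = ip 0 / kappa φ n := by
  rw [eq_div_iff (h.kappa_ne_zero n), mul_comm, waveSeq_self h hf]

/-- Multiplying the diagonal relation by κ_n turns the diagonal coefficient into the constant `ip 0`
in both the main term and the error bound. No lower bound on κ_n is needed, so κ_∞ ≠ 0 can be
deduced afterwards. -/
theorem kappa_limit_sq (h : IsOrtho W φ φbar) (hf : IsWienerHopf W p ip m im) {κinf : ℂ}
    (hκ : Tendsto (kappa φ) atTop (𝓝 κinf)) : κinf ^ 2 * m 0 = ip 0 := by
  have ht := ((tendsto_tail_left hf).mul (tendsto_tail_right hf)).const_mul (2 * ‖ip 0‖)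
  rw [mul_zero, mul_zero] at ht
  have h0 : Tendsto (fun n => kappa φ n ^ 2 * m 0 - ip 0) atTop (𝓝 0) := by
    refine squeeze_zero_norm' ?_ ht
    filter_upwards [eventually_l1_waveSeq_le h hf] with n hn
    have hk := h.kappa_ne_zero n
    have h1 := norm_kappa_sub_le h hf n
    have h2 := l1_tailSeq_le h hf n
    set δ := l1 (restr {k | k < -(n : ℤ)} (conv p im)) with hδ
    set ε := l1 (restr {k | (n : ℤ) < k} (conv m ip)) with hε
    have hδ0 : 0 ≤ δ := l1_nonneg _
    have hε0 : 0 ≤ ε := l1_nonneg _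
    have h3 : ‖kappa φ n * m 0 - waveSeq W φ ip n n‖ ≤ 2 * ‖waveSeq W φ ip n n‖ * δ * ε :=
      h1.trans (mul_le_mul_of_nonneg_right
        (h2.trans (mul_le_mul_of_nonneg_right hn hδ0)) hε0)
    have e : kappa φ n ^ 2 * m 0 - ip 0 =
        kappa φ n * (kappa φ n * m 0 - waveSeq W φ ip n n) := by
      rw [← waveSeq_self h hf n]; ring
    rw [e, norm_mul]
    refine (mul_le_mul_of_nonneg_left h3 (norm_nonneg _)).trans_eq ?_
    rw [← waveSeq_self h hf n, norm_mul]
    ring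
  have h1 : Tendsto (fun n => kappa φ n ^ 2 * m 0 - ip 0) atTop (𝓝 (κinf ^ 2 * m 0 - ip 0)) :=
    ((hκ.pow 2).mul_const _).sub_const _
  exact sub_eq_zero.mp (tendsto_nhds_unique h1 h0)

theorem kappa_limit_ne_zero (h : IsOrtho W φ φbar) (hf : IsWienerHopf W p ip m im) {κinf : ℂ}
    (hκ : Tendsto (kappa φ) atTop (𝓝 κinf)) : κinf ≠ 0 := by
  rintro rfl
  have := kappa_limit_sq h hf hκ
  exact right_ne_zero_of_mul_eq_one hf.p_zero_mul (by simpa using this.symm)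

theorem tendsto_waveSeq_self (h : IsOrtho W φ φbar) (hf : IsWienerHopf W p ip m im) {κinf : ℂ}
    (hκ : Tendsto (kappa φ) atTop (𝓝 κinf)) :
    Tendsto (fun n : ℕ => waveSeq W φ ip n n) atTop (𝓝 (ip 0 / κinf)) := by
  simp only [waveSeq_self_eq h hf]
  exact tendsto_const_nhds.div hκ (kappa_limit_ne_zero h hf hκ)

theorem tendsto_l1_tailSeq (h : IsOrtho W φ φbar) (hf : IsWienerHopf W p ip m im) {κinf : ℂ}
    (hκ : Tendsto (kappa φ) atTop (𝓝 κinf)) :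
    Tendsto (fun n : ℕ => l1 (tailSeq W φ im n)) atTop (𝓝 0) := by
  have ht := ((tendsto_waveSeq_self h hf hκ).norm.const_mul 2).mul (tendsto_tail_left hf)
  rw [mul_zero] at ht
  refine squeeze_zero' (Eventually.of_forall fun n => l1_nonneg _) ?_ ht
  filter_upwards [eventually_l1_waveSeq_le h hf] with n hn
  exact (l1_tailSeq_le h hf n).trans (mul_le_mul_of_nonneg_right hn (l1_nonneg _))

theorem tendsto_l1_waveSeq_sub (h : IsOrtho W φ φbar) (hf : IsWienerHopf W p ip m im) {κinf : ℂ}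
    (hκ : Tendsto (kappa φ) atTop (𝓝 κinf)) :
    Tendsto (fun n : ℕ => l1 (restr {k | k ≠ n} (waveSeq W φ ip n))) atTop (𝓝 0) := by
  have ht := (tendsto_l1_tailSeq h hf hκ).mul (tendsto_tail_right hf)
  rw [mul_zero] at ht
  exact squeeze_zero (fun n => l1_nonneg _) (fun n => l1_waveSeq_sub_le h hf n) ht

/-- The factorisation is normalised so that the scattering states have leading term `z ^ n`. -/
structure IsNormalised (W p ip m im : ℤ → ℂ) (κinf : ℂ) : Prop extends
    IsWienerHopf W p ip m im where
  ip_zero : ip 0 = κinf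
  im_zero : im 0 = κinf

theorem IsNormalised.symm {κinf : ℂ} (hf : IsNormalised W p ip m im κinf) :
    IsNormalised (reversed W) (reversed m) (reversed im) (reversed p) (reversed ip) κinf where
  toIsWienerHopf := hf.toIsWienerHopf.symm
  ip_zero := by simpa [reversed] using hf.im_zero
  im_zero := by simpa [reversed] using hf.ip_zero

/-- The factorisation has one free scalar but two conditions are imposed; `kappa_limit_sq` is
exactly their compatibility. -/
theorem IsWienerHopf.exists_normalised (h : IsOrtho W φ φbar) (hf : IsWienerHopf W p ip m im)
    {κinf : ℂ} (hκ : Tendsto (kappa φ) atTop (𝓝 κinf)) :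
    ∃ p ip m im, IsNormalised W p ip m im κinf := by
  have hκ0 := kappa_limit_ne_zero h hf hκ
  have hsq := kappa_limit_sq h hf hκ
  have hm := hf.m_zero_mul
  have hi : ip 0 ≠ 0 := right_ne_zero_of_mul_eq_one hf.p_zero_mul
  set s : ℂ := ip 0 / κinf with hs
  have hs0 : s ≠ 0 := div_ne_zero hi hκ0
  refine ⟨fun k => s * p k, fun k => s⁻¹ * ip k, fun k => s⁻¹ * m k, fun k => s * im k,
    ⟨⟨hf.summable_p.mul_left _, hf.summable_ip.mul_left _, hf.summable_m.mul_left _,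
      hf.summable_im.mul_left _, fun k hk => by simp [hf.p_neg k hk],
      fun k hk => by simp [hf.ip_neg k hk], fun k hk => by simp [hf.m_pos k hk],
      fun k hk => by simp [hf.im_pos k hk], fun z hz => ?_, fun z hz => ?_, fun z hz => ?_⟩,
      ?_, ?_⟩⟩
  · rw [laurentSum_const_mul, laurentSum_const_mul, mul_mul_mul_comm, mul_inv_cancel₀ hs0,
      one_mul, hf.p_mul_ip z hz]
  · rw [laurentSum_const_mul, laurentSum_const_mul, mul_mul_mul_comm, inv_mul_cancel₀ hs0,
      one_mul, hf.m_mul_im z hz]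
  · rw [laurentSum_const_mul, laurentSum_const_mul, mul_mul_mul_comm, mul_inv_cancel₀ hs0,
      one_mul, hf.p_mul_m z hz]
  · simp only [hs]
    field_simp
  · simp only [hs]
    rw [← hsq]
    field_simp
    linear_combination hm

/-! ### The scattering states -/

/-- The scattering state `Ψ_{+n}`. -/
def scatPlus (W : ℤ → ℂ) (φ φbar : ℕ → ℂ[X]) (ip : ℤ → ℂ) (n : ℕ) (z : ℂ) : Fin 2 → ℂ :=
  ![laurentSum (waveSeq W φ ip n) z, laurentSum (coSeq W φbar ip n) z]

/-- The scattering state `Ψ_{-n}`, by reflection. -/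
def scatMinus (W : ℤ → ℂ) (φ φbar : ℕ → ℂ[X]) (im : ℤ → ℂ) (n : ℕ) (z : ℂ) : Fin 2 → ℂ :=
  ![laurentSum (coSeq (reversed W) φ (reversed im) n) z⁻¹,
    laurentSum (waveSeq (reversed W) φbar (reversed im) n) z⁻¹]

theorem norm_laurentSum_waveSeq_sub_le (h : IsOrtho W φ φbar) (hf : IsWienerHopf W p ip m im)
    (n : ℕ) {z : ℂ} (hz : ‖z‖ ≤ 1) :
    ‖laurentSum (waveSeq W φ ip n) z - waveSeq W φ ip n n * z ^ n‖ ≤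
      l1 (restr {k | k ≠ n} (waveSeq W φ ip n)) := by
  have hx := summable_waveSeq h hf n
  have hx0 : ∀ k < 0, waveSeq W φ ip n k = 0 := fun k hk => waveSeq_eq_zero h hf (by omega)
  refine le_trans (le_of_eq ?_) (norm_laurentSum_le (summable_restr hx {k | k ≠ n})
    (fun k hk => by rw [restr_of_mem _ (by simp; omega), hx0 k hk]) hz)
  congr 1
  unfold laurentSum
  rw [(summable_disc hx hx0 hz).tsum_eq_add_tsum_ite (n : ℤ), zpow_natCast, add_sub_cancel_left]
  refine tsum_congr fun k => ?_
  split_ifs with hk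
  · rw [restr_of_notMem _ (by simpa using hk), zero_mul]
  · rw [restr_of_mem _ hk]

theorem isScatteringPlus_scatPlus {κinf : ℂ} (h : IsOrtho W φ φbar)
    (hf : IsNormalised W p ip m im κinf) (hκ : Tendsto (kappa φ) atTop (𝓝 κinf)) :
    IsScatteringPlus φ φbar (scatPlus W φ φbar ip) := by
  have hw := hf.toIsWienerHopf
  have hκ' : Tendsto (kappa φbar) atTop (𝓝 κinf) := hκ.congr fun n => (h.kappa_symm n).symm
  have hX := summable_waveSeq h hw
  have hZ := summable_coSeq h hw
  have hX0 : ∀ n, ∀ k < 0, waveSeq W φ ip n k = 0 := fun n k hk =>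
    waveSeq_eq_zero h hw (by omega)
  have hZ0 : ∀ n, ∀ k < 0, coSeq W φbar ip n k = 0 := fun n k hk => coSeq_eq_zero hw hk.le
  refine ⟨fun n i => ?_, fun n i => ?_, fun n z hz0 hz => ?_, fun z hz => ?_, fun z hz => ?_⟩
  · fin_cases i
    · exact differentiableOn_laurentSum (hX n) (hX0 n)
    · exact differentiableOn_laurentSum (hZ n) (hZ0 n)
  · fin_cases i
    · exact continuousOn_laurentSum (hX n) (hX0 n)
    · exact continuousOn_laurentSum (hZ n) (hZ0 n)
  · obtain ⟨e1, e2⟩ := wave_recurrence h hw n hz0 hz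
    have hk := h.kappa_ne_zero n
    rw [← eq_inv_mul_iff_mul_eq₀ hk] at e1 e2
    ext i
    fin_cases i
    · simp [scatPlus, transferMatrix, Matrix.mulVec, dotProduct, Fin.sum_univ_two, e1]
      ring
    · simp [scatPlus, transferMatrix, Matrix.mulVec, dotProduct, Fin.sum_univ_two, e2]
      ring
  · have h1 := tendsto_l1_waveSeq_sub h hw hκ
    have h2 := tendsto_waveSeq_self h hw hκ
    -- The normalisation enters here: the diagonal coefficient κ_∞/κ_n tends to 1.
    rw [hf.ip_zero, div_self (kappa_limit_ne_zero h hw hκ)] at h2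
    have h3 := h1.add (h2.sub_const 1).norm
    simp only [sub_self, norm_zero, add_zero] at h3
    refine squeeze_zero (fun n => norm_nonneg _) (fun n => ?_) h3
    have e : scatPlus W φ φbar ip n z 0 - z ^ n =
        (laurentSum (waveSeq W φ ip n) z - waveSeq W φ ip n n * z ^ n) +
          (waveSeq W φ ip n n - 1) * z ^ n := by
      simp only [scatPlus, Matrix.cons_val_zero]; ring
    rw [e]
    refine (norm_add_le _ _).trans
      (add_le_add (norm_laurentSum_waveSeq_sub_le h hw n hz) ?_)
    rw [norm_mul, norm_pow]
    exact mul_le_of_le_one_right (norm_nonneg _) (pow_le_one₀ (norm_nonneg _) hz)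
  · refine squeeze_zero (fun n => norm_nonneg _) (fun n => ?_)
      (tendsto_l1_tailSeq h.symm hw.symm hκ')
    exact (norm_laurentSum_le (hZ n) (hZ0 n) hz).trans_eq (l1_reversed _)

theorem isScatteringMinus_scatMinus {κinf : ℂ} (h : IsOrtho W φ φbar)
    (hf : IsNormalised W p ip m im κinf) (hκ : Tendsto (kappa φ) atTop (𝓝 κinf)) :
    IsScatteringMinus φ φbar (scatMinus W φ φbar im) := by
  have hκ' : Tendsto (kappa φbar) atTop (𝓝 κinf) := hκ.congr fun n => (h.kappa_symm n).symm
  have hp := isScatteringPlus_scatPlus h.symm hf.symm hκ'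
  have hinv : ∀ z : ℂ, 1 ≤ ‖z‖ → z⁻¹ ≠ 0 ∧ ‖z⁻¹‖ ≤ 1 := fun z hz =>
    ⟨inv_ne_zero (norm_pos_iff.mp (by linarith)), by rw [norm_inv]; exact inv_le_one_of_one_le₀ hz⟩
  have hs0 : ∀ n z, scatMinus W φ φbar im n z 0 =
      scatPlus (reversed W) φbar φ (reversed im) n z⁻¹ 1 := fun _ _ => rfl
  have hs1 : ∀ n z, scatMinus W φ φbar im n z 1 =
      scatPlus (reversed W) φbar φ (reversed im) n z⁻¹ 0 := fun _ _ => rfl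
  refine ⟨fun n i => ?_, fun n i => ?_, fun n z hz => ?_, fun z hz => ?_, fun z hz => ?_⟩
  · have hd : DifferentiableOn ℂ (fun z : ℂ => z⁻¹) {z | 1 < ‖z‖} := fun z hz =>
      (differentiableAt_inv (norm_pos_iff.mp (lt_trans one_pos hz))).differentiableWithinAt
    have hm : Set.MapsTo (fun z : ℂ => z⁻¹) {z | 1 < ‖z‖} {z | ‖z‖ < 1} := fun z hz => by
      simpa using inv_lt_one_of_one_lt₀ hz
    fin_cases i
    · exact (hp.differentiableOn n 1).comp hd hm
    · exact (hp.differentiableOn n 0).comp hd hm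
  · have hd : ContinuousOn (fun z : ℂ => z⁻¹) {z | 1 ≤ ‖z‖} := fun z hz =>
      (continuousAt_inv₀ (norm_pos_iff.mp (lt_of_lt_of_le one_pos hz))).continuousWithinAt
    have hm : Set.MapsTo (fun z : ℂ => z⁻¹) {z | 1 ≤ ‖z‖} {z | ‖z‖ ≤ 1} := fun z hz =>
      (hinv z hz).2
    fin_cases i
    · exact (hp.continuousOn n 1).comp hd hm
    · exact (hp.continuousOn n 0).comp hd hm
  · have e := hp.recurrence n z⁻¹ (hinv z hz).1 (hinv z hz).2
    have e0 := congrFun e 0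
    have e1 := congrFun e 1
    ext i
    fin_cases i
    · refine (hs0 _ _).trans (e1.trans ?_)
      simp [hs0, hs1, transferMatrix, Matrix.mulVec, dotProduct, Fin.sum_univ_two, h.kappa_symm]
      ring
    · refine (hs1 _ _).trans (e0.trans ?_)
      simp [hs0, hs1, transferMatrix, Matrix.mulVec, dotProduct, Fin.sum_univ_two, h.kappa_symm]
      ring
  · exact hp.tendsto_snd z⁻¹ (hinv z hz).2
  · have e := hp.tendsto_fst z⁻¹ (hinv z hz).2
    simp only [inv_pow] at e
    exact e

/-! ### Existence of the Wiener–Hopf factorisation -/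

/-- By continuity the imaginary part of g(s) - g(θ) stays within (-π, π) near θ, so this difference
is the principal logarithm of W(s)/W(θ). -/
theorem hasDerivAt_of_exp_eq {g W : ℝ → ℂ} {W' : ℂ} {θ : ℝ} (hg : Continuous g)
    (hW : ∀ s, Complex.exp (g s) = W s) (hd : HasDerivAt W W' θ) :
    HasDerivAt g (W' / W θ) θ := by
  have hne : W θ ≠ 0 := by rw [← hW]; exact Complex.exp_ne_zero _
  have h1 : HasDerivAt (fun s => W s / W θ) (W' / W θ) θ := hd.div_const _
  have h2 := h1.clog_real (by simp [div_self hne])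
  rw [div_self hne, div_one] at h2
  have h3 := h2.const_add (g θ)
  refine h3.congr_of_eventuallyEq ?_
  have ht : Tendsto (fun s => (g s - g θ).im) (𝓝 θ) (𝓝 0) := by
    have : Continuous fun s => (g s - g θ).im := Complex.continuous_im.comp (hg.sub continuous_const)
    simpa using this.tendsto θ
  filter_upwards [ht.eventually (lt_mem_nhds (neg_lt_zero.mpr Real.pi_pos)),
    ht.eventually (gt_mem_nhds Real.pi_pos)] with s hs1 hs2
  have e : W s / W θ = Complex.exp (g s - g θ) := by rw [Complex.exp_sub, hW, hW]
  rw [e, Complex.log_exp hs1 hs2.le]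
  ring

theorem circleMean_eq_intervalIntegral (f : ℂ → ℂ) :
    circleMean f = (2 * (Real.pi : ℂ))⁻¹ * ∫ θ in (0 : ℝ)..2 * Real.pi, f (circleMap 0 1 θ) := by
  unfold circleMean circleIntegral
  rw [mul_inv, mul_assoc, ← intervalIntegral.integral_const_mul]
  congr 2
  funext θ
  have h : circleMap 0 1 θ ≠ 0 := ne_zero_of_circle (by simp)
  simp only [deriv_circleMap, smul_eq_mul]
  field_simp

/-- Cauchy's estimate after moving the contour to radius R, which serves positive k, or to radius r,
which serves negative k. -/
theorem norm_fourierCoef_le {D : ℂ → ℂ} {r R : ℝ} (hr : 0 < r) (hr1 : r ≤ 1) (hR : 1 ≤ R)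
    (hD : ∀ z, r ≤ ‖z‖ → ‖z‖ ≤ R → DifferentiableAt ℂ D z) :
    ∃ C, ∀ k : ℤ, ‖fourierCoef D k‖ ≤ C * R ^ (-k) ∧ ‖fourierCoef D k‖ ≤ C * r ^ (-k) := by
  have hR0 : 0 < R := by linarith
  have hK : IsCompact {z : ℂ | r ≤ ‖z‖ ∧ ‖z‖ ≤ R} := by
    have : {z : ℂ | r ≤ ‖z‖ ∧ ‖z‖ ≤ R} = Metric.closedBall 0 R \ Metric.ball 0 r := by
      ext z; simp [and_comm]
    rw [this]
    exact (isCompact_closedBall 0 R).diff Metric.isOpen_ball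
  obtain ⟨C, hC⟩ := hK.exists_bound_of_continuousOn (f := D)
    fun z hz => (hD z hz.1 hz.2).continuousAt.continuousWithinAt
  have key : ∀ ρ : ℝ, 0 < ρ → r ≤ ρ → ρ ≤ R → ∀ k : ℤ,
      (∮ z in C(0, ρ), z⁻¹ * (D z * z ^ (-k))) = (∮ z in C(0, 1), z⁻¹ * (D z * z ^ (-k))) →
      ‖fourierCoef D k‖ ≤ C * ρ ^ (-k) := by
    intro ρ h0 h1 h2 k e
    unfold fourierCoef circleMean
    rw [← e, norm_mul, norm_inv]
    have hb := circleIntegral.norm_integral_le_of_norm_le_const (c := 0) (R := ρ)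
      (f := fun z => z⁻¹ * (D z * z ^ (-k))) (C := ρ⁻¹ * (C * ρ ^ (-k))) h0.le (fun z hz => by
        have hz : ‖z‖ = ρ := by simpa using hz
        rw [norm_mul, norm_mul, norm_inv, norm_zpow, hz]
        have := hC z ⟨by rw [hz]; exact h1, by rw [hz]; exact h2⟩
        gcongr)
    have hn : ‖2 * (Real.pi : ℂ) * Complex.I‖ = 2 * Real.pi := by
      simp [abs_of_pos Real.pi_pos]
    rw [hn]
    refine (mul_le_mul_of_nonneg_left hb (by positivity)).trans_eq ?_
    field_simp
  have hdiff : ∀ k : ℤ, ∀ z, r ≤ ‖z‖ → ‖z‖ ≤ R →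
      DifferentiableAt ℂ (fun z => z⁻¹ * (D z * z ^ (-k))) z := by
    intro k z h1 h2
    have hz : z ≠ 0 := norm_pos_iff.mp (by linarith)
    exact (differentiableAt_inv hz).mul ((hD z h1 h2).mul (differentiableAt_zpow.mpr (Or.inl hz)))
  have shift : ∀ a b : ℝ, 0 < a → r ≤ a → a ≤ b → b ≤ R → ∀ k : ℤ,
      (∮ z in C(0, b), z⁻¹ * (D z * z ^ (-k))) = (∮ z in C(0, a), z⁻¹ * (D z * z ^ (-k))) := by
    intro a b ha hra hab hbR k
    refine Complex.circleIntegral_eq_of_differentiable_on_annulus_off_countable ha hab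
      Set.countable_empty (fun z hz => ?_) (fun z hz => ?_)
    · have h1 : ‖z‖ ≤ b := by simpa using hz.1
      have h2 : a ≤ ‖z‖ := by simpa using hz.2
      exact (hdiff k z (by linarith) (by linarith)).continuousAt.continuousWithinAt
    · have h1 : ‖z‖ < b := by simpa using hz.1.1
      have h2 : a < ‖z‖ := by simpa using hz.1.2
      exact hdiff k z (by linarith) (by linarith)
  exact ⟨C, fun k => ⟨key R hR0 (by linarith) le_rfl k (shift 1 R one_pos hr1 hR le_rfl k),
    key r hr le_rfl (by linarith) k (shift r 1 hr le_rfl hr1 hR k).symm⟩⟩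

/-- Weierstrass's test on a smaller annulus a < |z| < b, where |z|^k ≤ a^k + b^k for every integer
k. -/
theorem differentiableAt_of_convergesInAnnulus {w : ℂ → ℂ} {Δ₁ Δ₂ : ℝ} (h0 : 0 ≤ Δ₁)
    (hw : ∀ z : ℂ, Δ₁ < ‖z‖ → ‖z‖ < Δ₂ → HasSum (fun k : ℤ => fourierCoef w k * z ^ k) (w z))
    {z : ℂ} (h1 : Δ₁ < ‖z‖) (h2 : ‖z‖ < Δ₂) : DifferentiableAt ℂ w z := by
  obtain ⟨a, ha1, ha2⟩ := exists_between h1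
  obtain ⟨b, hb1, hb2⟩ := exists_between h2
  have ha0 : 0 < a := by linarith
  have hb0 : 0 < b := by linarith
  have hU : IsOpen {z : ℂ | a < ‖z‖ ∧ ‖z‖ < b} :=
    (isOpen_lt continuous_const continuous_norm).inter
      (isOpen_lt continuous_norm continuous_const)
  have hab : a < b := by linarith
  have sa := (hw a (by rwa [Complex.norm_of_nonneg ha0.le])
    (by rw [Complex.norm_of_nonneg ha0.le]; linarith)).summable.norm
  have sb := (hw b (by rw [Complex.norm_of_nonneg hb0.le]; linarith)
    (by rwa [Complex.norm_of_nonneg hb0.le])).summable.norm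
  have hd := Complex.differentiableOn_tsum_of_summable_norm (sa.add sb)
    (F := fun (k : ℤ) z => fourierCoef w k * z ^ k) (U := {z : ℂ | a < ‖z‖ ∧ ‖z‖ < b})
    (fun k z hz => (DifferentiableAt.const_mul (differentiableAt_zpow.mpr
      (Or.inl (norm_pos_iff.mp (lt_trans ha0 hz.1)))) _).differentiableWithinAt) hU
    (fun k z hz => by
      have hz0 : 0 < ‖z‖ := lt_trans ha0 hz.1
      have hza : a < ‖z‖ := hz.1
      have hzb : ‖z‖ < b := hz.2
      simp only [norm_mul, norm_zpow, Complex.norm_of_nonneg ha0.le,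
        Complex.norm_of_nonneg hb0.le, ← mul_add]
      refine mul_le_mul_of_nonneg_left ?_ (norm_nonneg _)
      rcases le_total 0 k with hk | hk
      · have h3 : ‖z‖ ^ k ≤ b ^ k := zpow_le_zpow_left₀ hk hz0.le hzb.le
        have h4 : 0 < a ^ k := zpow_pos ha0 k
        linarith
      · have h3 : ‖z‖ ^ k ≤ a ^ k := by
          have h5 := inv_anti₀ (zpow_pos ha0 (-k))
            (zpow_le_zpow_left₀ (neg_nonneg.mpr hk) ha0.le hza.le)
          simpa only [zpow_neg, inv_inv] using h5
        have h4 : 0 < b ^ k := zpow_pos hb0 k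
        linarith)
  have hz : z ∈ {z : ℂ | a < ‖z‖ ∧ ‖z‖ < b} := ⟨ha2, hb1⟩
  refine ((hd.differentiableAt (hU.mem_nhds hz))).congr_of_eventuallyEq ?_
  filter_upwards [hU.mem_nhds hz] with y hy
  exact (hw y (by linarith [hy.1]) (by linarith [hy.2])).tsum_eq.symm

theorem exists_annulus_subset {s : Set ℂ} (hs : IsOpen s) (hT : Metric.sphere 0 1 ⊆ s) :
    ∃ r R : ℝ, 0 < r ∧ r < 1 ∧ 1 < R ∧ ∀ z : ℂ, r ≤ ‖z‖ → ‖z‖ ≤ R → z ∈ s := by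
  obtain ⟨δ, hδ, hsub⟩ := (isCompact_sphere (0 : ℂ) 1).exists_thickening_subset_open hs hT
  set ε := min (δ / 2) (1 / 2) with hε
  have hε0 : 0 < ε := by positivity
  have hε1 : ε ≤ 1 / 2 := min_le_right _ _
  have hε2 : ε < δ := (min_le_left _ _).trans_lt (by linarith)
  refine ⟨1 - ε, 1 + ε, by linarith, by linarith, by linarith, fun z h1 h2 => hsub ?_⟩
  have hz : 0 < ‖z‖ := by linarith
  have hz' : (‖z‖ : ℂ) ≠ 0 := by exact_mod_cast hz.ne'
  -- The witness is the radial projection of z onto the circle, at distance | |z| - 1 |.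
  refine Metric.mem_thickening_iff.mpr ⟨(‖z‖ : ℂ)⁻¹ * z, ?_, ?_⟩
  · simp [hz.ne']
  · rw [dist_eq_norm, show z - (‖z‖ : ℂ)⁻¹ * z = ((‖z‖ - 1 : ℝ) : ℂ) * ((‖z‖ : ℂ)⁻¹ * z) by
      push_cast; field_simp, norm_mul, Complex.norm_real]
    have : ‖(‖z‖ : ℂ)⁻¹ * z‖ = 1 := by simp [hz.ne']
    rw [this, mul_one, Real.norm_eq_abs]
    exact (abs_le.mpr ⟨by linarith, by linarith⟩).trans_lt hε2

/-- Integration by parts in the angle. The boundary terms cancel because L is single-valued on the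
circle, which is where zero winding number enters. -/
theorem fourierCoef_logDeriv {w L : ℂ → ℂ} (hL : ContinuousOn L (Metric.sphere 0 1))
    (hexp : ∀ z ∈ Metric.sphere (0 : ℂ) 1, Complex.exp (L z) = w z)
    (hw : ∀ z, ‖z‖ = 1 → DifferentiableAt ℂ w z)
    (hc : ContinuousOn (fun z => z * deriv w z / w z) (Metric.sphere 0 1)) (k : ℤ) :
    fourierCoef (fun z => z * deriv w z / w z) k = k * fourierCoef L k := by
  have hcirc : ∀ θ : ℝ, ‖circleMap 0 1 θ‖ = 1 := fun θ => by simp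
  have hmem : ∀ θ : ℝ, circleMap 0 1 θ ∈ Metric.sphere (0 : ℂ) 1 := fun θ => by simp
  have hg : Continuous fun θ : ℝ => L (circleMap 0 1 θ) :=
    hL.comp_continuous (continuous_circleMap 0 1) hmem
  have hD : Continuous fun θ : ℝ =>
      (fun z => z * deriv w z / w z) (circleMap 0 1 θ) :=
    hc.comp_continuous (continuous_circleMap 0 1) hmem
  have hz : Continuous fun θ : ℝ => (circleMap 0 1 θ) ^ (-k) :=
    (continuous_circleMap 0 1).zpow₀ _ fun θ => Or.inl (ne_zero_of_circle (hcirc θ))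
  have hdg : ∀ θ : ℝ, HasDerivAt (fun θ : ℝ => L (circleMap 0 1 θ))
      (Complex.I * (fun z => z * deriv w z / w z) (circleMap 0 1 θ)) θ := fun θ => by
    have h1 : HasDerivAt (fun θ : ℝ => w (circleMap 0 1 θ))
        (deriv w (circleMap 0 1 θ) * (circleMap 0 1 θ * Complex.I)) θ :=
      (hw _ (hcirc θ)).hasDerivAt.comp θ (hasDerivAt_circleMap 0 1 θ)
    have h2 := hasDerivAt_of_exp_eq hg (fun s => hexp _ (hmem s)) h1
    convert h2 using 1
    simp only []
    ring
  have hdz : ∀ θ : ℝ, HasDerivAt (fun θ : ℝ => (circleMap 0 1 θ) ^ (-k))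
      (-k * Complex.I * (circleMap 0 1 θ) ^ (-k)) θ := fun θ => by
    have h0 := ne_zero_of_circle (hcirc θ)
    have h1 := (hasDerivAt_zpow (-k) (circleMap 0 1 θ) (Or.inl h0)).comp θ
      (hasDerivAt_circleMap 0 1 θ)
    refine h1.congr_deriv ?_
    rw [zpow_sub_one₀ h0]
    push_cast
    field_simp
  have hcont : Continuous fun θ : ℝ => Complex.I * (fun z => z * deriv w z / w z)
      (circleMap 0 1 θ) * (circleMap 0 1 θ) ^ (-k) + L (circleMap 0 1 θ) *
        (-k * Complex.I * (circleMap 0 1 θ) ^ (-k)) :=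
    ((continuous_const.mul hD).mul hz).add (hg.mul (continuous_const.mul hz))
  have hint := intervalIntegral.integral_eq_sub_of_hasDerivAt (a := 0) (b := 2 * Real.pi)
    (f := fun θ : ℝ => L (circleMap 0 1 θ) * (circleMap 0 1 θ) ^ (-k))
    (fun θ _ => (hdg θ).mul (hdz θ)) (hcont.intervalIntegrable _ _)
  have hper : circleMap 0 1 (2 * Real.pi) = circleMap 0 1 0 := by simp [circleMap]
  simp only [hper, sub_self] at hint
  unfold fourierCoef
  rw [circleMean_eq_intervalIntegral, circleMean_eq_intervalIntegral]
  have i1 : IntervalIntegrable (fun θ : ℝ => Complex.I * ((fun z => z * deriv w z / w z)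
      (circleMap 0 1 θ) * (circleMap 0 1 θ) ^ (-k))) volume 0 (2 * Real.pi) :=
    (continuous_const.mul (hD.mul hz)).intervalIntegrable _ _
  have i2 : IntervalIntegrable (fun θ : ℝ => Complex.I * k * (L (circleMap 0 1 θ) *
      (circleMap 0 1 θ) ^ (-k))) volume 0 (2 * Real.pi) :=
    (continuous_const.mul (hg.mul hz)).intervalIntegrable _ _
  have e : (∫ θ in (0 : ℝ)..2 * Real.pi, Complex.I * (fun z => z * deriv w z / w z)
      (circleMap 0 1 θ) * (circleMap 0 1 θ) ^ (-k) + L (circleMap 0 1 θ) *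
        (-k * Complex.I * (circleMap 0 1 θ) ^ (-k))) =
      Complex.I * (∫ θ in (0 : ℝ)..2 * Real.pi, (fun z => z * deriv w z / w z)
        (circleMap 0 1 θ) * (circleMap 0 1 θ) ^ (-k)) - Complex.I * k *
      ∫ θ in (0 : ℝ)..2 * Real.pi, L (circleMap 0 1 θ) * (circleMap 0 1 θ) ^ (-k) := by
    rw [← intervalIntegral.integral_const_mul, ← intervalIntegral.integral_const_mul,
      ← intervalIntegral.integral_sub i1 i2]
    congr 1
    funext θ
    ring
  have e2 := e.symm.trans hint
  have e3 := mul_left_cancel₀ Complex.I_ne_zero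
    ((sub_eq_zero.mp e2).trans (mul_assoc Complex.I (k : ℂ) _))
  rw [e3]
  ring

theorem hasSum_fourierCoef {L : ℂ → ℂ} (hL : ContinuousOn L (Metric.sphere 0 1))
    (hs : Summable (fourierCoef L)) {z : ℂ} (hz : ‖z‖ = 1) :
    L z = laurentSum (fourierCoef L) z := by
  have : Fact (0 < 2 * Real.pi) := ⟨Real.two_pi_pos⟩
  let f : C(AddCircle (2 * Real.pi), ℂ) :=
    ⟨fun x => L (AddCircle.toCircle x), hL.comp_continuous
      (continuous_induced_dom.comp AddCircle.continuous_toCircle)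
      fun x => mem_sphere_zero_iff_norm.mpr (Circle.norm_coe _)⟩
  have hcm : ∀ θ : ℝ, ((AddCircle.toCircle (θ : AddCircle (2 * Real.pi)) : Circle) : ℂ) =
      circleMap 0 1 θ := fun θ => by
    rw [AddCircle.toCircle_apply_mk, Circle.coe_exp, circleMap]
    simp [Real.pi_ne_zero]
  have hfou : ∀ (k : ℤ) (θ : ℝ), (fourier k (θ : AddCircle (2 * Real.pi)) : ℂ) =
      (circleMap 0 1 θ) ^ k := fun k θ => by
    rw [fourier_apply, AddCircle.toCircle_zsmul, Circle.coe_zpow, hcm]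
  have hco : ∀ k, fourierCoeff f k = fourierCoef L k := fun k => by
    rw [fourierCoeff_eq_intervalIntegral _ _ 0, fourierCoef, circleMean_eq_intervalIntegral,
      zero_add, Complex.real_smul]
    congr 1
    · push_cast; simp
    · congr 1
      funext θ
      rw [hfou, smul_eq_mul, mul_comm]
      simp [f, hcm]
  have hs' : Summable (fourierCoeff f) := by
    rwa [show fourierCoeff f = fourierCoef L from funext hco]
  obtain ⟨θ, hθ⟩ : ∃ θ : ℝ, circleMap 0 1 θ = z := by
    refine ⟨Complex.arg z, ?_⟩
    simpa [circleMap, hz] using Complex.norm_mul_exp_arg_mul_I z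
  have h := (has_pointwise_sum_fourier_series_of_summable hs' (θ : AddCircle (2 * Real.pi))).tsum_eq
  simp only [hco, hfou, hθ, smul_eq_mul] at h
  rw [← hθ, ← hcm]
  refine Eq.trans ?_ (h.symm.trans ?_)
  · rfl
  · rw [hcm, hθ]; rfl

/-- Geometric decay makes the exponential holomorphic on a disc of radius larger than 1. Its Taylor
series therefore converges at z = 1, which gives summable coefficients. -/
theorem exists_exp_seq {c : ℕ → ℂ} {C q : ℝ} (hq0 : 0 < q) (hq1 : q < 1)
    (hc : ∀ k, ‖c k‖ ≤ C * q ^ k) : ∃ e : ℤ → ℂ, Summable e ∧ (∀ k < 0, e k = 0) ∧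
      ∀ z, ‖z‖ = 1 → laurentSum e z = Complex.exp (∑' k, c k * z ^ k) := by
  obtain ⟨R, hR1, hR2⟩ := exists_between ((one_lt_inv₀ hq0).mpr hq1)
  obtain ⟨R', hR'1, hR'2⟩ := exists_between hR1
  have hR0 : 0 < R := by linarith
  have hqR : q * R < 1 := by rwa [lt_inv_comm₀ hR0 hq0, ← one_div, lt_div_iff₀ hR0] at hR2
  have hd : DifferentiableOn ℂ (fun z => ∑' k, c k * z ^ k) (Metric.ball 0 R) := by
    refine Complex.differentiableOn_tsum_of_summable_norm (u := fun k => C * (q * R) ^ k)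
      ((summable_geometric_of_lt_one (by positivity) hqR).mul_left C)
      (fun k => by fun_prop) Metric.isOpen_ball fun k z hz => ?_
    have hz : ‖z‖ < R := by simpa using hz
    have hC : 0 ≤ C * q ^ k := (norm_nonneg _).trans (hc k)
    rw [norm_mul, norm_pow, mul_pow, ← mul_assoc]
    exact mul_le_mul (hc k) (pow_le_pow_left₀ (norm_nonneg _) hz.le k) (by positivity) hC
  lift R' to NNReal using by linarith
  have hps := (hd.cexp.mono (Metric.closedBall_subset_ball hR'2)).hasFPowerSeriesOnBall
    (by exact_mod_cast (show (0 : ℝ) < R' by linarith))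
  set P := cauchyPowerSeries (fun z => Complex.exp (∑' k, c k * z ^ k)) 0 (R' : ℝ) with hP
  have hsum : ∀ z : ℂ, ‖z‖ = 1 →
      HasSum (fun k : ℕ => P.coeff k * z ^ k) (Complex.exp (∑' k, c k * z ^ k)) := fun z hz => by
    have h := hps.hasSum (y := z) (by
      rw [Metric.mem_eball, edist_zero_right]
      rw [← ofReal_norm, hz, ENNReal.ofReal_one]
      exact_mod_cast hR'1)
    simpa [FormalMultilinearSeries.apply_eq_pow_smul_coeff, mul_comm] using h
  have hi : Function.Injective ((↑) : ℕ → ℤ) := Nat.cast_injective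
  have hsum' : ∀ z : ℂ, ‖z‖ = 1 →
      HasSum (fun k : ℤ => (if 0 ≤ k then P.coeff k.toNat else 0) * z ^ k)
        (Complex.exp (∑' k, c k * z ^ k)) := fun z hz => by
    rw [← hi.hasSum_iff]
    · simpa [Function.comp_def] using hsum z hz
    · intro k hk
      rw [if_neg, zero_mul]
      exact fun hc => hk ⟨k.toNat, by simp [hc]⟩
  refine ⟨fun k => if 0 ≤ k then P.coeff k.toNat else 0, ?_, fun k hk => if_neg (not_le.mpr hk),
    fun z hz => (hsum' z hz).tsum_eq⟩
  simpa using (hsum' 1 (by simp)).summable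

/-- The Fourier coefficients of log w decay geometrically, so log w splits into a power series in z
and one in 1/z. Their exponentials, and those of their negatives, are the factors and the inverses.
-/
theorem exists_wienerHopf {w : ℂ → ℂ} (hw : ConvergesInAnnulus w) (hS : SzegoCondition w) :
    ∃ p ip m im, IsWienerHopf (fourierCoef w) p ip m im := by
  obtain ⟨Δ₁, Δ₂, h0, h1, h2, hsum⟩ := hw
  obtain ⟨L, hL, hexp, -⟩ := hS
  have hT1 : ∀ z : ℂ, ‖z‖ = 1 → Complex.exp (L z) = w z := fun z hz => hexp z (by simpa using hz)
  have hU : IsOpen {z : ℂ | Δ₁ < ‖z‖ ∧ ‖z‖ < Δ₂} :=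
    (isOpen_lt continuous_const continuous_norm).inter
      (isOpen_lt continuous_norm continuous_const)
  have hd : ∀ z ∈ {z : ℂ | Δ₁ < ‖z‖ ∧ ‖z‖ < Δ₂}, DifferentiableAt ℂ w z := fun z hz =>
    differentiableAt_of_convergesInAnnulus h0 hsum hz.1 hz.2
  have hdw : DifferentiableOn ℂ w {z : ℂ | Δ₁ < ‖z‖ ∧ ‖z‖ < Δ₂} := fun z hz =>
    (hd z hz).differentiableWithinAt
  have hs : IsOpen ({z : ℂ | Δ₁ < ‖z‖ ∧ ‖z‖ < Δ₂} ∩ w ⁻¹' {0}ᶜ) :=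
    hdw.continuousOn.isOpen_inter_preimage hU isOpen_compl_singleton
  obtain ⟨r, R, hr0, hr1, hR1, hrR⟩ := exists_annulus_subset hs fun z hz => by
    have hz1 : ‖z‖ = 1 := by simpa using hz
    refine ⟨⟨by rwa [hz1], by rwa [hz1]⟩, ?_⟩
    simp only [Set.mem_preimage, Set.mem_compl_iff, Set.mem_singleton_iff]
    rw [← hT1 z hz1]
    exact Complex.exp_ne_zero _
  -- L is given only on the circle, but z w'/w is holomorphic in an annulus. Its coefficients are k
  -- times those of L, so decay transfers to L for k ≠ 0.
  have hD : ∀ z : ℂ, r ≤ ‖z‖ → ‖z‖ ≤ R →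
      DifferentiableAt ℂ (fun z => z * deriv w z / w z) z := fun z h3 h4 => by
    have hz := hrR z h3 h4
    exact (differentiableAt_id.mul ((hdw.deriv hU).differentiableAt (hU.mem_nhds hz.1))).div
      (hd z hz.1) hz.2
  have hDT : ∀ z : ℂ, ‖z‖ = 1 → DifferentiableAt ℂ (fun z => z * deriv w z / w z) z :=
    fun z hz => hD z (by linarith) (by linarith)
  obtain ⟨C, hC⟩ := norm_fourierCoef_le hr0 hr1.le hR1.le hD
  have hco := fourierCoef_logDeriv hL hexp
    (fun z hz => hd z ⟨by rwa [hz], by rwa [hz]⟩)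
    (fun z hz => (hDT z (by simpa using hz)).continuousAt.continuousWithinAt)
  set ℓ := fourierCoef L with hℓ
  set q := max R⁻¹ r with hq
  have hq0 : 0 < q := lt_max_of_lt_right hr0
  have hq1 : q < 1 := max_lt (inv_lt_one_of_one_lt₀ hR1) hr1
  -- The logarithmic derivative does not see the coefficient at 0, which is bounded separately.
  set B := max C ‖ℓ 0‖ with hB
  have hC0 : 0 ≤ C := by simpa using (norm_nonneg _).trans (hC 0).1
  have hle : ∀ k : ℤ, k ≠ 0 → ‖ℓ k‖ ≤ ‖fourierCoef (fun z => z * deriv w z / w z) k‖ := by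
    intro k hk
    rw [hco, norm_mul, Complex.norm_intCast]
    refine le_mul_of_one_le_left (norm_nonneg _) ?_
    exact_mod_cast Int.one_le_abs hk
  have hpos : ∀ k : ℕ, ‖ℓ k‖ ≤ B * q ^ k := by
    intro k
    rcases Nat.eq_zero_or_pos k with rfl | hk
    · simp [hB]
    · refine (hle k (by exact_mod_cast hk.ne')).trans ((hC k).1.trans ?_)
      rw [zpow_neg, zpow_natCast, ← inv_pow]
      exact mul_le_mul (le_max_left _ _)
        (pow_le_pow_left₀ (by positivity) (le_max_left _ _) k) (by positivity)
        (hC0.trans (le_max_left _ _))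
  -- The coefficient at 0 is assigned to the plus factor, so it is removed here.
  have hneg : ∀ k : ℕ, ‖if k = 0 then 0 else ℓ (-(k : ℤ))‖ ≤ B * q ^ k := by
    intro k
    split_ifs with hk
    · rw [norm_zero]
      exact mul_nonneg (hC0.trans (le_max_left _ _)) (by positivity)
    · refine (hle (-(k : ℤ)) (by simpa using hk)).trans ((hC (-(k : ℤ))).2.trans ?_)
      rw [neg_neg, zpow_natCast]
      exact mul_le_mul (le_max_left _ _) (pow_le_pow_left₀ hr0.le (le_max_right _ _) k)
        (by positivity) (hC0.trans (le_max_left _ _))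
  have hB0 : 0 ≤ B := hC0.trans (le_max_left _ _)
  have hgeo := (summable_geometric_of_lt_one hq0.le hq1).mul_left B
  have hsplus : ∀ z : ℂ, ‖z‖ = 1 → Summable fun k : ℕ => ℓ k * z ^ k := fun z hz =>
    hgeo.of_norm_bounded fun k => by simpa [hz] using hpos k
  have hsminus : ∀ z : ℂ, ‖z‖ = 1 →
      Summable fun k : ℕ => (if k = 0 then 0 else ℓ (-(k : ℤ))) * z ^ k := fun z hz =>
    hgeo.of_norm_bounded fun k => by
      rw [norm_mul, norm_pow, hz, one_pow, mul_one]; exact hneg k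
  have hLsum : ∀ z : ℂ, ‖z‖ = 1 → HasSum (fun k : ℤ => ℓ k * z ^ k)
      ((∑' k : ℕ, ℓ k * z ^ k) +
        ∑' k : ℕ, (if k = 0 then 0 else ℓ (-(k : ℤ))) * z⁻¹ ^ k) := fun z hz => by
    refine HasSum.of_nat_of_neg_add_one (by simpa using (hsplus z hz).hasSum) ?_
    have h3 := (hasSum_nat_add_iff' 1).mpr (hsminus z⁻¹ (by simp [hz])).hasSum
    simp only [Finset.sum_range_one, if_true, zero_mul, sub_zero] at h3
    refine h3.congr_fun fun k => ?_
    rw [if_neg (by omega), inv_pow, ← zpow_natCast, ← zpow_neg]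
    push_cast
    rfl
  have hsum1 : Summable ℓ := by simpa using (hLsum 1 (by simp)).summable
  have hLz : ∀ z : ℂ, ‖z‖ = 1 → L z = (∑' k : ℕ, ℓ k * z ^ k) +
      ∑' k : ℕ, (if k = 0 then 0 else ℓ (-(k : ℤ))) * z⁻¹ ^ k := fun z hz => by
    rw [hasSum_fourierCoef hL hsum1 hz]
    exact (hLsum z hz).tsum_eq
  obtain ⟨p, hp1, hp2, hp3⟩ := exists_exp_seq hq0 hq1 hpos
  obtain ⟨ip, hip1, hip2, hip3⟩ := exists_exp_seq (c := fun k => -ℓ k) hq0 hq1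
    fun k => by rw [norm_neg]; exact hpos k
  obtain ⟨m, hm1, hm2, hm3⟩ := exists_exp_seq hq0 hq1 hneg
  obtain ⟨im, him1, him2, him3⟩ := exists_exp_seq
    (c := fun k => -if k = 0 then 0 else ℓ (-(k : ℤ))) hq0 hq1
    fun k => by rw [norm_neg]; exact hneg k
  have hinv : ∀ z : ℂ, ‖z‖ = 1 → ‖z⁻¹‖ = 1 := fun z hz => by simp [hz]
  refine ⟨p, ip, reversed m, reversed im, hp1, hip1, summable_reversed hm1,
    summable_reversed him1, hp2, hip2,
    fun k hk => hm2 _ (by omega), fun k hk => him2 _ (by omega), fun z hz => ?_, fun z hz => ?_,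
    fun z hz => ?_⟩
  · rw [hp3 z hz, hip3 z hz, ← Complex.exp_add]
    simp only [neg_mul, tsum_neg, add_neg_cancel, Complex.exp_zero]
  · rw [laurentSum_reversed, laurentSum_reversed, hm3 _ (hinv z hz), him3 _ (hinv z hz),
      ← Complex.exp_add]
    simp only [neg_mul, tsum_neg, add_neg_cancel, Complex.exp_zero]
  · rw [laurentSum_reversed, hp3 z hz, hm3 _ (hinv z hz), ← Complex.exp_add, ← hLz z hz, hT1 z hz]
    exact (hsum z (by rwa [hz]) (by rwa [hz])).tsum_eq.symm

/-! ### Uniqueness of the scattering data -/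

/-- The transfer matrix has determinant one. The recurrence for w φ_{n+1} at index n + 1 and the
reflected recurrence at index 0 share one unknown coefficient; eliminating it gives the identity. -/
theorem IsOrtho.kappa_sq_sub (h : IsOrtho W φ φbar) (n : ℕ) :
    kappa φ (n + 1) ^ 2 - (φ (n + 1)).eval 0 * (φbar (n + 1)).eval 0 = kappa φ n ^ 2 := by
  have e1 := h.weighted_succ n ((n + 1 : ℕ) : ℤ)
  have e2 := h.symm.weighted_succ n 0
  have e3 := h.symm.weighted_eq_zero (n := n + 1) (k := 0) (by omega)
  have k0 := h.kappa_mul_weighted n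
  have k1 := h.kappa_mul_weighted (n + 1)
  rw [reversed_reversed, h.kappa_symm, h.kappa_symm, sub_zero, zero_sub] at e2
  rw [Nat.cast_zero] at e3
  rw [e3, mul_zero] at e2
  rw [show (((n + 1 : ℕ) : ℤ) - 1) = n by push_cast; ring,
    show ((n : ℤ) - ((n + 1 : ℕ) : ℤ)) = -1 by push_cast; ring] at e1
  linear_combination kappa φ n ^ 2 * k1 - kappa φ n * kappa φ (n + 1) * e1 +
    kappa φ n * (φ (n + 1)).eval 0 * e2 -
    (kappa φ (n + 1) ^ 2 - (φ (n + 1)).eval 0 * (φbar (n + 1)).eval 0) * k0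

/-- The Wronskian of two vectors. -/
def wronskian (a b : Fin 2 → ℂ) : ℂ := a 0 * b 1 - a 1 * b 0

theorem wronskian_transferMatrix (h : IsOrtho W φ φbar) (n : ℕ) {z : ℂ} (hz : z ≠ 0)
    (a b : Fin 2 → ℂ) : wronskian ((transferMatrix φ φbar n z).mulVec a)
      ((transferMatrix φ φbar n z).mulVec b) = wronskian a b := by
  have hk := h.kappa_ne_zero n
  have e := h.kappa_sq_sub n
  simp only [wronskian, transferMatrix, Matrix.mulVec, dotProduct, Fin.sum_univ_two,
    Matrix.smul_apply, Matrix.of_apply, Matrix.cons_val', Matrix.cons_val_zero,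
    Matrix.cons_val_one, Matrix.cons_val_fin_one, smul_eq_mul]
  field_simp
  linear_combination z * z ^ n * (a 0 * b 1 - a 1 * b 0) * e

theorem wronskian_eq (h : IsOrtho W φ φbar) {z : ℂ} (hz : z ≠ 0) {a b : ℕ → Fin 2 → ℂ}
    (ha : ∀ n, a (n + 1) = (transferMatrix φ φbar n z).mulVec (a n))
    (hb : ∀ n, b (n + 1) = (transferMatrix φ φbar n z).mulVec (b n)) {c : ℂ}
    (hc : Tendsto (fun n => wronskian (a n) (b n)) atTop (𝓝 c)) (n : ℕ) :
    wronskian (a n) (b n) = c := by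
  have h0 : ∀ n, wronskian (a n) (b n) = wronskian (a 0) (b 0) := by
    intro n
    induction n with
    | zero => rfl
    | succ n ih => rw [ha, hb, wronskian_transferMatrix h n hz, ih]
  rw [h0 n]
  exact tendsto_nhds_unique (tendsto_const_nhds.congr fun k => (h0 k).symm) hc

theorem IsScatteringPlus.tendsto_scaled {Ψ : ℕ → ℂ → Fin 2 → ℂ}
    (hΨ : IsScatteringPlus φ φbar Ψ) {z : ℂ} (hz : ‖z‖ = 1) :
    Tendsto (fun n => Ψ n z 0 * (z ^ n)⁻¹) atTop (𝓝 1) ∧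
      Tendsto (fun n => Ψ n z 1 * z ^ n) atTop (𝓝 0) := by
  have hz0 := ne_zero_of_circle hz
  constructor
  · rw [tendsto_iff_norm_sub_tendsto_zero]
    refine (hΨ.tendsto_fst z hz.le).congr fun n => ?_
    have : Ψ n z 0 * (z ^ n)⁻¹ - 1 = (Ψ n z 0 - z ^ n) * (z ^ n)⁻¹ := by field_simp
    rw [this, norm_mul, norm_inv, norm_pow, hz, one_pow, inv_one, mul_one]
  · rw [tendsto_zero_iff_norm_tendsto_zero]
    exact (hΨ.tendsto_snd z hz.le).congr fun n => by simp [hz]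

theorem IsScatteringMinus.tendsto_scaled {Ψ : ℕ → ℂ → Fin 2 → ℂ}
    (hΨ : IsScatteringMinus φ φbar Ψ) {z : ℂ} (hz : ‖z‖ = 1) :
    Tendsto (fun n => Ψ n z 0 * (z ^ n)⁻¹) atTop (𝓝 0) ∧
      Tendsto (fun n => Ψ n z 1 * z ^ n) atTop (𝓝 1) := by
  have hz0 := ne_zero_of_circle hz
  constructor
  · rw [tendsto_zero_iff_norm_tendsto_zero]
    exact (hΨ.tendsto_fst z hz.ge).congr fun n => by simp [hz]
  · rw [tendsto_iff_norm_sub_tendsto_zero]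
    refine (hΨ.tendsto_snd z hz.ge).congr fun n => ?_
    have : Ψ n z 1 * z ^ n - 1 = (Ψ n z 1 - (z ^ n)⁻¹) * z ^ n := by field_simp
    rw [this, norm_mul, norm_pow, hz, one_pow, mul_one]

theorem tendsto_wronskian {a b : ℕ → Fin 2 → ℂ} {z : ℂ} (hz : z ≠ 0) {a0 a1 b0 b1 : ℂ}
    (ha0 : Tendsto (fun n => a n 0 * (z ^ n)⁻¹) atTop (𝓝 a0))
    (ha1 : Tendsto (fun n => a n 1 * z ^ n) atTop (𝓝 a1))
    (hb0 : Tendsto (fun n => b n 0 * (z ^ n)⁻¹) atTop (𝓝 b0))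
    (hb1 : Tendsto (fun n => b n 1 * z ^ n) atTop (𝓝 b1)) :
    Tendsto (fun n => wronskian (a n) (b n)) atTop (𝓝 (a0 * b1 - a1 * b0)) := by
  refine ((ha0.mul hb1).sub (ha1.mul hb0)).congr fun n => ?_
  unfold wronskian
  field_simp

theorem wronskian_plus_minus (h : IsOrtho W φ φbar) {Ψp Ψm : ℕ → ℂ → Fin 2 → ℂ}
    (hp : IsScatteringPlus φ φbar Ψp) (hm : IsScatteringMinus φ φbar Ψm) {z : ℂ} (hz : ‖z‖ = 1)
    (n : ℕ) : wronskian (Ψp n z) (Ψm n z) = 1 := by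
  have hz0 := ne_zero_of_circle hz
  refine wronskian_eq h hz0 (a := fun n => Ψp n z) (b := fun n => Ψm n z)
    (fun n => hp.recurrence n z hz0 hz.le) (fun n => hm.recurrence n z hz.ge) ?_ n
  simpa using tendsto_wronskian hz0 (hp.tendsto_scaled hz).1 (hp.tendsto_scaled hz).2
    (hm.tendsto_scaled hz).1 (hm.tendsto_scaled hz).2

/-- The Wronskian of two plus states is zero at n = ∞, hence always, so the two are proportional.
Their equal Wronskians with the minus state make the factor 1. -/
theorem scatteringPlus_unique (h : IsOrtho W φ φbar) {Ψ Ψ' Ψm : ℕ → ℂ → Fin 2 → ℂ}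
    (hΨ : IsScatteringPlus φ φbar Ψ) (hΨ' : IsScatteringPlus φ φbar Ψ')
    (hm : IsScatteringMinus φ φbar Ψm) {z : ℂ} (hz : ‖z‖ = 1) (n : ℕ) : Ψ n z = Ψ' n z := by
  have hz0 := ne_zero_of_circle hz
  have e1 := wronskian_plus_minus h hΨ hm hz n
  have e2 := wronskian_plus_minus h hΨ' hm hz n
  have e3 : wronskian (Ψ n z) (Ψ' n z) = 0 := by
    refine wronskian_eq h hz0 (a := fun n => Ψ n z) (b := fun n => Ψ' n z)
      (fun n => hΨ.recurrence n z hz0 hz.le) (fun n => hΨ'.recurrence n z hz0 hz.le) ?_ n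
    simpa using tendsto_wronskian hz0 (hΨ.tendsto_scaled hz).1 (hΨ.tendsto_scaled hz).2
      (hΨ'.tendsto_scaled hz).1 (hΨ'.tendsto_scaled hz).2
  unfold wronskian at e1 e2 e3
  ext i
  fin_cases i
  · simp only [Fin.zero_eta]
    linear_combination Ψ' n z 0 * e1 - Ψ n z 0 * e2 - Ψm n z 0 * e3
  · simp only [Fin.mk_one]
    linear_combination Ψ' n z 1 * e1 - Ψ n z 1 * e2 - Ψm n z 1 * e3

theorem scatteringMinus_unique (h : IsOrtho W φ φbar) {Ψ Ψ' Ψp : ℕ → ℂ → Fin 2 → ℂ}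
    (hΨ : IsScatteringMinus φ φbar Ψ) (hΨ' : IsScatteringMinus φ φbar Ψ')
    (hp : IsScatteringPlus φ φbar Ψp) {z : ℂ} (hz : ‖z‖ = 1) (n : ℕ) : Ψ n z = Ψ' n z := by
  have hz0 := ne_zero_of_circle hz
  have e1 := wronskian_plus_minus h hp hΨ hz n
  have e2 := wronskian_plus_minus h hp hΨ' hz n
  have e3 : wronskian (Ψ n z) (Ψ' n z) = 0 := by
    refine wronskian_eq h hz0 (a := fun n => Ψ n z) (b := fun n => Ψ' n z)
      (fun n => hΨ.recurrence n z hz.ge) (fun n => hΨ'.recurrence n z hz.ge) ?_ n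
    simpa using tendsto_wronskian hz0 (hΨ.tendsto_scaled hz).1 (hΨ.tendsto_scaled hz).2
      (hΨ'.tendsto_scaled hz).1 (hΨ'.tendsto_scaled hz).2
  unfold wronskian at e1 e2 e3
  ext i
  fin_cases i
  · simp only [Fin.zero_eta]
    linear_combination Ψ' n z 0 * e1 - Ψ n z 0 * e2 + Ψp n z 0 * e3
  · simp only [Fin.mk_one]
    linear_combination Ψ' n z 1 * e1 - Ψ n z 1 * e2 + Ψp n z 1 * e3

/-! ### The scattering system -/

theorem coSeq_reversed (W : ℤ → ℂ) (φ : ℕ → ℂ[X]) (im : ℤ → ℂ) (n : ℕ) :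
    coSeq (reversed W) φ (reversed im) n = reversed (tailSeq W φ im n) := by
  rw [coSeq, reversed_reversed, reversed_reversed]

theorem areJostFunctions (h : IsOrtho W φ φbar) (hf : IsWienerHopf W p ip m im) :
    AreJostFunctions φ φbar (scatPlus W φ φbar ip) (scatMinus W φ φbar im)
      (laurentSum ip) (laurentSum im) := by
  intro n z hz
  have hz' : ‖z⁻¹‖ = 1 := by simp [hz]
  have e1 := eval_eq_add h hf n hz
  have e2 := eval_eq_add h.symm hf.symm n hz'
  rw [laurentSum_reversed, laurentSum_reversed, inv_inv] at e2
  ext i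
  fin_cases i
  · simp [scatPlus, scatMinus, coSeq_reversed, laurentSum_reversed, e1]
  · simp [scatPlus, scatMinus, coSeq, laurentSum_reversed, e2]
    ring

theorem haveExpansions (h : IsOrtho W φ φbar) (hf : IsWienerHopf W p ip m im) :
    HaveExpansions (scatPlus W φ φbar ip) (scatMinus W φ φbar im)
      (fun n k => waveSeq W φ ip n k) (fun n k => coSeq W φbar ip n k)
      (fun n k => waveSeq (reversed W) φbar (reversed im) n k)
      (fun n k => coSeq (reversed W) φ (reversed im) n k) := by
  have hinv : ∀ z : ℂ, 1 < ‖z‖ → ‖z⁻¹‖ ≤ 1 := fun z hz => by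
    rw [norm_inv]; exact inv_le_one_of_one_le₀ hz.le
  refine ⟨fun n z hz => ?_, fun n z hz => ?_, fun n z hz => ?_, fun n z hz => ?_⟩
  · exact hasSum_nat_laurentSum (summable_waveSeq h hf n)
      (fun k hk => waveSeq_eq_zero h hf hk) hz.le
  · have e := hasSum_nat_laurentSum (n := 1) (summable_coSeq h hf n)
      (fun k hk => coSeq_eq_zero hf (by push_cast at hk; omega)) hz.le
    simp only [add_comm 1] at e
    exact e
  · have e := hasSum_nat_laurentSum (summable_waveSeq h.symm hf.symm n)
      (fun k hk => waveSeq_eq_zero h.symm hf.symm hk) (hinv z hz)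
    simp only [inv_pow] at e
    exact e
  · have e := hasSum_nat_laurentSum (n := 1) (summable_coSeq h.symm hf.symm n)
      (fun k hk => coSeq_eq_zero hf.symm (by push_cast at hk; omega)) (hinv z hz)
    simp only [inv_pow, add_comm 1] at e
    exact e

theorem isScatteringSystem {κinf : ℂ} (h : IsOrtho W φ φbar)
    (hf : IsNormalised W p ip m im κinf) (hκ : Tendsto (kappa φ) atTop (𝓝 κinf)) :
    IsScatteringSystem φ φbar (scatPlus W φ φbar ip) (scatMinus W φ φbar im)
      (laurentSum ip) (laurentSum im)
      (fun n k => waveSeq W φ ip n k) (fun n k => coSeq W φbar ip n k)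
      (fun n k => waveSeq (reversed W) φbar (reversed im) n k)
      (fun n k => coSeq (reversed W) φ (reversed im) n k) :=
  ⟨isScatteringPlus_scatPlus h hf hκ, isScatteringMinus_scatMinus h hf hκ,
    areJostFunctions h hf.toIsWienerHopf, haveExpansions h hf.toIsWienerHopf⟩

/-! ### The Marchenko relations as absolutely convergent series -/

theorem hasSum_conv_of_neg {a b : ℤ → ℂ} (ha : Summable a) (hb : Summable b)
    (h0 : ∀ j ≥ 0, a j = 0) (k : ℤ) :
    HasSum (fun j : ℕ => a (-((j + 1 : ℕ) : ℤ)) * b (((j + 1 : ℕ) : ℤ) + k)) (conv a b k) := by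
  have h := (summable_conv_apply ha hb k).hasSum
  have hi : Function.Injective fun j : ℕ => -((j + 1 : ℕ) : ℤ) := fun i j hij => by
    simpa using hij
  rw [← hi.hasSum_iff] at h
  · refine h.congr_fun fun j => ?_
    simp only [Function.comp_apply]
    congr 2; ring
  · intro j hj
    rw [h0 j, zero_mul]
    by_contra! hc
    exact hj ⟨(-j - 1).toNat, by push_cast; omega⟩

theorem hasSum_conv_of_ge {a b : ℤ → ℂ} (ha : Summable a) (hb : Summable b) {n : ℕ}
    (h0 : ∀ j < (n : ℤ), a j = 0) (k : ℤ) :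
    HasSum (fun j : ℕ => a ((n + j : ℕ) : ℤ) * b (k - ((n + j : ℕ) : ℤ))) (conv a b k) := by
  have h := (summable_conv_apply ha hb k).hasSum
  have hi : Function.Injective fun j : ℕ => ((n + j : ℕ) : ℤ) := fun i j hij => by
    simpa using hij
  rw [← hi.hasSum_iff] at h
  · exact h
  · intro j hj
    rw [h0 j, zero_mul]
    by_contra! hc
    exact hj ⟨(j - n).toNat, by push_cast; omega⟩

/-- Two of the four Marchenko relations; the other two follow by reflection. -/
theorem marchenko_relations {κinf : ℂ} (h : IsOrtho W φ φbar)
    (hf : IsNormalised W p ip m im κinf) {A B : ℕ → ℕ → ℂ} {F G : ℤ → ℂ}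
    (hA : ∀ n k, A n (n + k) = waveSeq W φ ip n ((n + k : ℕ) : ℤ))
    (hB : ∀ n k, B n (k + 1) = tailSeq W φ im n (-((k + 1 : ℕ) : ℤ)))
    (hF : ∀ k, F k = conv p im (-k)) (hG : ∀ k, G k = conv m ip k) :
    (∀ l n : ℕ, n ≤ l →
      Summable (fun k : ℕ => B n (k + 1) * G ((k + 1 : ℕ) + l)) ∧
      kappa φ n / κinf * (if l = n then 1 else 0) =
        A n l + ∑' k : ℕ, B n (k + 1) * G ((k + 1 : ℕ) + l)) ∧
    (∀ l n : ℕ, 0 < l →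
      Summable (fun k : ℕ => A n (n + k) * F ((n + k : ℕ) + l)) ∧
      0 = B n l + ∑' k : ℕ, A n (n + k) * F ((n + k : ℕ) + l)) := by
  have hw := hf.toIsWienerHopf
  -- The normalisation turns the left side κ_n m₀ of the first relation into κ_n/κ_∞.
  have hm0 : m 0 = κinf⁻¹ := by
    have := hw.m_zero_mul
    rw [hf.im_zero] at this
    exact eq_inv_of_mul_eq_one_left this
  constructor
  · intro l n hnl
    have hs := hasSum_conv_of_neg (summable_tailSeq h hw n)
      (summable_conv hw.summable_m hw.summable_ip) (fun j hj => tailSeq_eq_zero hw hj) (l : ℤ)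
    simp only [hB, hG]
    refine ⟨hs.summable, ?_⟩
    rw [hs.tsum_eq]
    obtain ⟨k, rfl⟩ := Nat.exists_eq_add_of_le hnl
    rw [hA, ← marchenko_wave h hw (by exact_mod_cast hnl), hm0]
    simp [div_eq_mul_inv]
  · intro l n hl
    have hs := hasSum_conv_of_ge (summable_waveSeq h hw n)
      (summable_conv hw.summable_p hw.summable_im)
      (fun j hj => waveSeq_eq_zero h hw hj) (-(l : ℤ))
    have e : ∀ k : ℕ, -(l : ℤ) - ((n + k : ℕ) : ℤ) = -(((n + k : ℕ) : ℤ) + l) := fun k => by ring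
    simp only [e] at hs
    simp only [hA, hF]
    refine ⟨hs.summable, ?_⟩
    rw [hs.tsum_eq]
    obtain ⟨k, rfl⟩ := Nat.exists_eq_add_of_lt hl
    rw [zero_add, hB, add_comm, ← marchenko_tail h hw (by push_cast; omega)]

theorem IsBiorthonormalSystem.isOrtho {w : ℂ → ℂ} (h : IsBiorthonormalSystem w φ φbar)
    (hs : Summable (fourierCoef w)) (hw : ∀ z, ‖z‖ = 1 → w z = laurentSum (fourierCoef w) z) :
    IsOrtho (fourierCoef w) φ φbar where
  summable := hs
  natDegree_left := h.natDegree_left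
  natDegree_right := h.natDegree_right
  coeff_left n := by rw [kappa, Polynomial.leadingCoeff, h.natDegree_left]
  coeff_right n := by
    rw [kappa, ← h.leadingCoeff_eq, Polynomial.leadingCoeff, h.natDegree_right]
  orth i j := by
    rw [← h.orthonormal i j, weighted, ← pair_eq_circleMean
      (f := fun z => w z * (φ i).eval z) (summable_conv hs (summable_polySeq _))]
    intro z hz
    rw [laurentSum_conv_circle hs (summable_polySeq _) hz, laurentSum_polySeq, hw z hz]

theorem ConvergesInAnnulus.summable {w : ℂ → ℂ} (hw : ConvergesInAnnulus w) :
    Summable (fourierCoef w) := by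
  obtain ⟨Δ₁, Δ₂, -, h1, h2, hsum⟩ := hw
  simpa using (hsum 1 (by simpa) (by simpa)).summable

theorem ConvergesInAnnulus.eq_laurentSum {w : ℂ → ℂ} (hw : ConvergesInAnnulus w) {z : ℂ}
    (hz : ‖z‖ = 1) : w z = laurentSum (fourierCoef w) z := by
  obtain ⟨Δ₁, Δ₂, -, h1, h2, hsum⟩ := hw
  exact (hsum z (by rwa [hz]) (by rwa [hz])).tsum_eq.symm

theorem circleIntegrable_of_eq_laurentSum {a : ℤ → ℂ} (ha : Summable a) {f : ℂ → ℂ}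
    (hf : ∀ z, ‖z‖ = 1 → f z = laurentSum a z) : CircleIntegrable f 0 1 :=
  ContinuousOn.circleIntegrable zero_le_one
    ((continuousOn_sphere_laurentSum ha).congr fun z hz => hf z (by simpa using hz))

/-! ### Identification of an arbitrary scattering system with the constructed one -/

section System

variable {κinf : ℂ} {Ψp Ψm : ℕ → ℂ → Fin 2 → ℂ} {fp fm : ℂ → ℂ} {A₁ A₂ B₁ B₂ : ℕ → ℕ → ℂ}

/-- Cramer's rule at n = 0: the two scattering states form a basis with Wronskian 1. -/
theorem jost_eq (h : IsOrtho W φ φbar) (hf : IsNormalised W p ip m im κinf)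
    (hκ : Tendsto (kappa φ) atTop (𝓝 κinf))
    (hs : IsScatteringSystem φ φbar Ψp Ψm fp fm A₁ A₂ B₁ B₂) {z : ℂ} (hz : ‖z‖ = 1) :
    fp z = laurentSum ip z ∧ fm z = laurentSum im z := by
  have hs0 := isScatteringSystem h hf hκ
  have ep := scatteringPlus_unique h hs.plus hs0.plus hs.minus hz 0
  have em := scatteringMinus_unique h hs.minus hs0.minus hs.plus hz 0
  have e1 := hs.jost 0 z hz
  rw [hs0.jost 0 z hz, ← ep, ← em] at e1
  have hw := wronskian_plus_minus h hs.plus hs.minus hz 0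
  have e10 := congrFun e1 0
  have e11 := congrFun e1 1
  simp only [Pi.add_apply, Pi.smul_apply, smul_eq_mul] at e10 e11
  unfold wronskian at hw
  constructor
  · linear_combination (laurentSum ip z - fp z) * hw + Ψp 0 z 1 * e10 - Ψp 0 z 0 * e11
  · linear_combination (laurentSum im z - fm z) * hw - Ψm 0 z 1 * e10 + Ψm 0 z 0 * e11

/-- Uniqueness of the state is available on the circle only. That suffices, because the power series
coefficients are the Fourier coefficients of the boundary values. -/
theorem coeff_plus_eq (h : IsOrtho W φ φbar) (hf : IsNormalised W p ip m im κinf)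
    (hκ : Tendsto (kappa φ) atTop (𝓝 κinf))
    (hs : IsScatteringSystem φ φbar Ψp Ψm fp fm A₁ A₂ B₁ B₂) (n k : ℕ) :
    A₁ n (n + k) = waveSeq W φ ip n ((n + k : ℕ) : ℤ) ∧
      A₂ n (k + 1) = coSeq W φbar ip n ((k + 1 : ℕ) : ℤ) := by
  have hs0 := isScatteringSystem h hf hκ
  have hw := hf.toIsWienerHopf
  have ep : ∀ z, ‖z‖ = 1 → Ψp n z = scatPlus W φ φbar ip n z := fun z hz =>
    scatteringPlus_unique h hs.plus hs0.plus hs.minus hz n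
  constructor
  · rw [coeff_eq_fourierCoef (f := fun z => Ψp n z 0) (c := fun k => A₁ n (n + k))
      ((hs.plus.continuousOn n 0).mono fun z hz => hz.2)
      (fun z _ hz => hs.expansions.plus_fst n z hz) k]
    exact fourierCoef_of_eq (summable_waveSeq h hw n) (fun z hz => congrFun (ep z hz) 0) _
  · rw [coeff_eq_fourierCoef (f := fun z => Ψp n z 1) (c := fun k => A₂ n (k + 1)) (n := 1)
      ((hs.plus.continuousOn n 1).mono fun z hz => hz.2)
      (fun z _ hz => by
        have e := hs.expansions.plus_snd n z hz
        simp only [add_comm 1]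
        exact e) k, add_comm 1]
    exact fourierCoef_of_eq (summable_coSeq h hw n) (fun z hz => congrFun (ep z hz) 1) _

theorem coeff_minus_eq (h : IsOrtho W φ φbar) (hf : IsNormalised W p ip m im κinf)
    (hκ : Tendsto (kappa φ) atTop (𝓝 κinf))
    (hs : IsScatteringSystem φ φbar Ψp Ψm fp fm A₁ A₂ B₁ B₂) (n k : ℕ) :
    B₁ n (n + k) = waveSeq (reversed W) φbar (reversed im) n ((n + k : ℕ) : ℤ) ∧
      B₂ n (k + 1) = coSeq (reversed W) φ (reversed im) n ((k + 1 : ℕ) : ℤ) := by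
  have hs0 := isScatteringSystem h hf hκ
  have hw := hf.toIsWienerHopf
  have em : ∀ z, ‖z‖ = 1 → Ψm n z⁻¹ = scatMinus W φ φbar im n z⁻¹ := fun z hz =>
    scatteringMinus_unique h hs.minus hs0.minus hs.plus (by simp [hz]) n
  have hcont : ∀ i, ContinuousOn (fun z => Ψm n z⁻¹ i) {z | z ≠ 0 ∧ ‖z‖ ≤ 1} := fun i =>
    (hs.minus.continuousOn n i).comp
      (fun z hz => (continuousAt_inv₀ hz.1).continuousWithinAt) fun z hz => by
        simpa using (one_le_inv₀ (norm_pos_iff.mpr hz.1)).mpr hz.2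
  have hinv : ∀ z : ℂ, z ≠ 0 → ‖z‖ < 1 → 1 < ‖z⁻¹‖ := fun z h0 hz => by
    simpa using (one_lt_inv₀ (norm_pos_iff.mpr h0)).mpr hz
  constructor
  · rw [coeff_eq_fourierCoef (f := fun z => Ψm n z⁻¹ 1) (c := fun k => B₁ n (n + k)) (hcont 1)
      (fun z h0 hz => by
        have e := hs.expansions.minus_snd n z⁻¹ (hinv z h0 hz)
        simp only [inv_pow, inv_inv] at e
        exact e) k]
    refine fourierCoef_of_eq (summable_waveSeq h.symm hw.symm n) (fun z hz => ?_) _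
    simp [em z hz, scatMinus]
  · rw [coeff_eq_fourierCoef (f := fun z => Ψm n z⁻¹ 0) (c := fun k => B₂ n (k + 1)) (n := 1)
      (hcont 0)
      (fun z h0 hz => by
        have e := hs.expansions.minus_fst n z⁻¹ (hinv z h0 hz)
        simp only [inv_pow, inv_inv] at e
        simp only [add_comm 1]
        exact e) k, add_comm 1]
    refine fourierCoef_of_eq (summable_coSeq h.symm hw.symm n) (fun z hz => ?_) _
    simp [em z hz, scatMinus]

end System

end Marchenko

end

theorem mainTheorem5 (w : ℂ → ℂ) (φ φbar : ℕ → ℂ[X]) (κinf : ℂ)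
    (hw : Marchenko.ConvergesInAnnulus w)
    (hφ : Marchenko.IsBiorthonormalSystem w φ φbar)
    (h_i : Marchenko.IsLpSymbol w)
    (h_ii : Marchenko.SzegoCondition w)
    (h_iii : Summable fun n : ℕ =>
      Real.sqrt ‖Marchenko.reflCoeff φ n * Marchenko.reflCoeff φbar n‖)
    (h_iv : Tendsto (Marchenko.kappa φ) atTop (𝓝 κinf)) :
    κinf ≠ 0 ∧
    (∃ (Ψp Ψm : ℕ → ℂ → Fin 2 → ℂ) (fp fm : ℂ → ℂ) (A₁ A₂ B₁ B₂ : ℕ → ℕ → ℂ),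
      Marchenko.IsScatteringSystem φ φbar Ψp Ψm fp fm A₁ A₂ B₁ B₂) ∧
    ∀ (Ψp Ψm : ℕ → ℂ → Fin 2 → ℂ) (fp fm : ℂ → ℂ) (A₁ A₂ B₁ B₂ : ℕ → ℕ → ℂ),
      Marchenko.IsScatteringSystem φ φbar Ψp Ψm fp fm A₁ A₂ B₁ B₂ →
      (∀ z : ℂ, ‖z‖ = 1 → fp z ≠ 0 ∧ fm z ≠ 0) ∧
      CircleIntegrable (Marchenko.scatteringFun fp fm) 0 1 ∧
      CircleIntegrable (fun z => 1 / Marchenko.scatteringFun fp fm z) 0 1 ∧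
      (∀ m n : ℕ, 1 ≤ n → n ≤ m →
        Summable (fun k : ℕ => B₂ n (k + 1) * Marchenko.scatFbar fp fm ((k + 1 : ℕ) + m)) ∧
        Marchenko.kappa φ n / κinf * (if m = n then 1 else 0) =
          A₁ n m + ∑' k : ℕ, B₂ n (k + 1) * Marchenko.scatFbar fp fm ((k + 1 : ℕ) + m)) ∧
      (∀ m n : ℕ, 0 < m → 0 < n →
        Summable (fun k : ℕ => A₁ n (n + k) * Marchenko.scatF fp fm ((n + k : ℕ) + m)) ∧
        0 = B₂ n m + ∑' k : ℕ, A₁ n (n + k) * Marchenko.scatF fp fm ((n + k : ℕ) + m)) ∧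
      (∀ m n : ℕ, 1 ≤ n → n ≤ m →
        Summable (fun k : ℕ => A₂ n (k + 1) * Marchenko.scatF fp fm ((k + 1 : ℕ) + m)) ∧
        Marchenko.kappa φ n / κinf * (if m = n then 1 else 0) =
          B₁ n m + ∑' k : ℕ, A₂ n (k + 1) * Marchenko.scatF fp fm ((k + 1 : ℕ) + m)) ∧
      (∀ m n : ℕ, 0 < m → 0 < n →
        Summable (fun k : ℕ => B₁ n (n + k) * Marchenko.scatFbar fp fm ((n + k : ℕ) + m)) ∧
        0 = A₂ n m + ∑' k : ℕ, B₁ n (n + k) * Marchenko.scatFbar fp fm ((n + k : ℕ) + m)) := by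
  open Marchenko in
  have h : IsOrtho (fourierCoef w) φ φbar :=
    hφ.isOrtho hw.summable fun z hz => hw.eq_laurentSum hz
  obtain ⟨p, ip, q, iq, hf0⟩ := exists_wienerHopf hw h_ii
  have hκ0 := kappa_limit_ne_zero h hf0 h_iv
  obtain ⟨p, ip, q, iq, hf⟩ := hf0.exists_normalised h h_iv
  have hwh := hf.toIsWienerHopf
  refine ⟨hκ0, ⟨_, _, _, _, _, _, _, _, isScatteringSystem h hf h_iv⟩, ?_⟩
  intro Ψp Ψm fp fm A₁ A₂ B₁ B₂ hs
  have hjost := fun z (hz : ‖z‖ = 1) => jost_eq h hf h_iv hs hz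
  have hsU := summable_conv hwh.summable_p hwh.summable_im
  have hsV := summable_conv hwh.summable_m hwh.summable_ip
  have hne : ∀ z : ℂ, ‖z‖ = 1 → fp z ≠ 0 ∧ fm z ≠ 0 := fun z hz => by
    rw [(hjost z hz).1, (hjost z hz).2]
    exact ⟨right_ne_zero_of_mul_eq_one (hwh.p_mul_ip z hz),
      right_ne_zero_of_mul_eq_one (hwh.m_mul_im z hz)⟩
  -- With f_- = 1/w₋ and f_+ = 1/w₊ this is S = w₊/w₋.
  have hS : ∀ z : ℂ, ‖z‖ = 1 → scatteringFun fp fm z = laurentSum (conv p iq) z := fun z hz => by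
    rw [scatteringFun, div_eq_iff (hne z hz).1, (hjost z hz).1, (hjost z hz).2,
      laurentSum_conv_circle hwh.summable_p hwh.summable_im hz]
    linear_combination -laurentSum iq z * hwh.p_mul_ip z hz
  have hS' : ∀ z : ℂ, ‖z‖ = 1 → 1 / scatteringFun fp fm z = laurentSum (conv q ip) z :=
    fun z hz => by
      rw [scatteringFun, one_div_div, div_eq_iff (hne z hz).2, (hjost z hz).1, (hjost z hz).2,
        laurentSum_conv_circle hwh.summable_m hwh.summable_ip hz]
      linear_combination -laurentSum ip z * hwh.m_mul_im z hz
  have hF : ∀ k, scatF fp fm k = conv p iq (-k) := fun k => by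
    rw [← fourierCoef_of_eq hsU hS, fourierCoef, scatF, neg_neg]
    simp only [mul_comm]
  have hG : ∀ k, scatFbar fp fm k = conv q ip k := fun k => by
    rw [← fourierCoef_of_eq hsV hS', fourierCoef, scatFbar]
    simp only [mul_comm]
  have r1 := marchenko_relations h hf (A := A₁) (B := B₂) (F := scatF fp fm)
    (G := scatFbar fp fm) (fun n k => (coeff_plus_eq h hf h_iv hs n k).1)
    (fun n k => by rw [(coeff_minus_eq h hf h_iv hs n k).2, coSeq_reversed]; rfl) hF hG
  -- Reflection exchanges S with 1/S, hence F with Fbar, and the plus coefficients with the minus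
  -- ones.
  have r2 := marchenko_relations h.symm hf.symm (A := B₁) (B := A₂) (F := scatFbar fp fm)
    (G := scatF fp fm) (fun n k => (coeff_minus_eq h hf h_iv hs n k).1)
    (fun n k => (coeff_plus_eq h hf h_iv hs n k).2)
    (fun k => by rw [hG, ← reversed_conv, reversed, neg_neg])
    (fun k => by rw [hF, ← reversed_conv, reversed])
  simp only [h.kappa_symm] at r2
  exact ⟨hne, circleIntegrable_of_eq_laurentSum hsU hS, circleIntegrable_of_eq_laurentSum hsV hS',
    fun m n _ hmn => r1.1 m n hmn, fun m n hm _ => r1.2 m n hm,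
    fun m n _ hmn => r2.1 m n hmn, fun m n hm _ => r2.2 m n hm⟩
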